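/- Let $X$ be a one-dimensional complex manifold, let $f\colon X\to\mathbb{C}$ be a holomorphic function all of whose critical points are non-degenerate, and let $\nu$ be a holomorphic $1$-form on $X$. Let $a$ be a critical point of $f$, put $\alpha=f(a)$, and let $\theta\in\mathbb{R}$. Let $\mathcal{C}=\mathcal{C}_a^\theta$ be the Lefschetz thimble through $a$ in direction $\theta$: the connected component containing $a$ of $f^{-1}(\alpha+e^{i\theta}[0,\infty))$, with a chosen orientation, where it is assumed that $a$ is the only critical point of $f$ on $\mathcal{C}$ and that both halves of $\mathcal{C}$ starting at $a$ run out to infinity along the ray (so $\mathcal{C}$ is the image of an injective regular $C^1$ curve $\gamma\colon\mathbb{R}\to X$ with $\gamma(0)=a$ and $|f(\gamma(s))|\to\infty$ as $s\to\pm\infty$, which induces the orientation). Put $$I_a(z)=\int_{\mathcal{C}}e^{-zf}\,\nu,$$ let $D$ be the set of all $z\in\mathbb{C}$ at which this integral converges absolutely, and suppose that $D\neq\emptyset$. Below, fractional powers of $z$ are taken with the branch of $\arg z$ that equals $-\theta$ on the ray $e^{-i\theta}(0,\infty)$, and fractional powers of $\zeta-\alpha$ with the branch of $\arg(\zeta-\alpha)$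 that equals $\theta$ on the ray $\alpha+e^{i\theta}(0,\infty)$. Then $I_a$ is Borel regular. That is: 1. $I_a$ has an asymptotic expansion in the direction $-\theta$ in the space $e^{-z\alpha}z^{-1/2}\,\mathbb{C}[[z^{-1}]]$: there are $c_0,c_1,\dots\in\mathbb{C}$ and an open sector $S=\{\rho e^{i(-\theta+\psi)} : \rho>R,\ |\psi|<\delta\}\subseteq D$ (with $R>0$ and $0<\delta\le\pi$) such that $I_a$ is holomorphic on $S$ and, for every $n\ge 0$, $$I_a(z)-e^{-z\alpha}\sum_{k=0}^{n}c_k z^{-1/2-k}=o\big(e^{-z\alpha}z^{-1/2-n}\big)$$ as $z\to\infty$ along each ray of $S$. 2. For this expansion (that is, for every sequence $(c_n)$ as in 1), the Borel transform $$\tilde\iota_a=\sum_{n\ge 0}\frac{c_n}{\Gamma(n+\frac12)}\,(\zeta-\alpha)^{n-1/2}$$ converges near $\zeta=\alpha$: the power series $\sum_n \frac{c_n}{\Gamma(n+1/2)}x^n$ has a positive radius of convergence. 3. The sum of $\tilde\iota_a$ continues analytically along the ray $\alpha+e^{i\theta}(0,\infty)$: there is a holomorphic function $\iota_a$ on an open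 set that contains this ray and a half-disk $\{|\zeta-\alpha|<r,\ \mathrm{Re}(e^{-i\theta}(\zeta-\alpha))>0\}$, equal on the half-disk to the sum of $\tilde\iota_a$. Moreover, for every $z\in D$ its Laplace integral along the ray converges absolutely, and $$\int_{\alpha+e^{i\theta}(0,\infty)}e^{-z\zeta}\,\iota_a(\zeta)\,d\zeta=I_a(z).$$ -/

import Mathlib

open scoped Manifold
open MeasureTheory Filter

noncomputable section

namespace Thimble

/-! ### Rays, sectors, fractional powers -/

/-- The closed ray `{α + t e^{iθ} : t ≥ 0}`. -/
def ray (α : ℂ) (θ : ℝ) : Set ℂ :=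
  {ζ | ∃ t : ℝ, 0 ≤ t ∧ ζ = α + t * Complex.exp (θ * Complex.I)}

/-- The open ray `{α + t e^{iθ} : t > 0}`. -/
def openRay (α : ℂ) (θ : ℝ) : Set ℂ :=
  {ζ | ∃ t : ℝ, 0 < t ∧ ζ = α + t * Complex.exp (θ * Complex.I)}

/-- The open sector at infinity of half-opening `δ` around the direction `β`, truncated to
`|z| > R`. -/
def sectorAtInfty (β δ R : ℝ) : Set ℂ :=
  {z | ∃ ρ ψ : ℝ, R < ρ ∧ |ψ| < δ ∧ z = ρ * Complex.exp ((β + ψ : ℝ) * Complex.I)}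

/-- The branch of `u ↦ u ^ σ` determined by the (extended) direction `β`: for
`u = ρ e^{i(β + ψ)}` with `ρ > 0` and `|ψ| < π` it is `ρ ^ σ e^{i(β + ψ)σ}`. -/
def dirPow (β : ℝ) (u : ℂ) (σ : ℝ) : ℂ :=
  Complex.exp (β * σ * Complex.I) * (Complex.exp (-(β * Complex.I)) * u) ^ (σ : ℂ)

/-! ### Asymptotic expansions, Borel and Laplace transforms

The sequence `c` stands for the formal trans-monomial series
`e^{-αz} z^{-τ} ∑ c n z^{-n}`, an element of `e^{-αz} z^{-τ} ℂ⟦z⁻¹⟧`. -/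

/-- The function `Φ`, with domain `D`, is asymptotic to `e^{-αz} z^{-τ} ∑ c n z^{-n}` in the
direction `β`: on some open sector at infinity, contained in `D`, around the ray of direction `β`,
the function `Φ` is holomorphic and, along each ray of the sector, for every order `n`, the error
of the `n`-th partial sum is `o(e^{-αz} z^{-τ-n})`. Powers of `z` are those of direction `β`. -/
def HasAsymptoticExpansion (D : Set ℂ) (Φ : ℂ → ℂ) (β : ℝ) (α : ℂ) (τ : ℝ) (c : ℕ → ℂ) : Prop :=
  ∃ δ R : ℝ, 0 < δ ∧ δ ≤ Real.pi ∧ 0 < R ∧ sectorAtInfty β δ R ⊆ D ∧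
    DifferentiableOn ℂ Φ (sectorAtInfty β δ R) ∧
    ∀ ψ : ℝ, |ψ| < δ → ∀ n : ℕ,
      let z : ℝ → ℂ := fun ρ => ρ * Complex.exp ((β + ψ : ℝ) * Complex.I)
      (fun ρ : ℝ => Φ (z ρ) -
          Complex.exp (-(α * z ρ)) * ∑ k ∈ Finset.range (n + 1), c k * dirPow β (z ρ) (-τ - k))
        =o[atTop] (fun ρ : ℝ => Complex.exp (-(α * z ρ)) * dirPow β (z ρ) (-τ - n))

/-- The Borel transform of `e^{-αz} z^{-τ} ∑ c n z^{-n}` is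
`∑ (c n / Γ(τ + n)) (ζ - α)^{τ - 1 + n}`; this is its sequence of coefficients. -/
def borelCoeff (τ : ℝ) (c : ℕ → ℂ) (n : ℕ) : ℂ :=
  c n / (Real.Gamma (τ + n) : ℂ)

/-- The shifted power series `(ζ - α)^{τ - 1} ∑ b n (ζ - α)^n` converges near `α`: the power
series `∑ b n x^n` has a positive radius of convergence. -/
def ConvergesNearTip (b : ℕ → ℂ) : Prop :=
  ∃ r : ℝ, 0 < r ∧ Summable fun n => ‖b n‖ * r ^ n

/-- `φ` is, on `U`, an analytic continuation along the ray `α + e^{iθ}(0, ∞)` of the sum of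
`∑ b n (ζ - α)^{τ - 1 + n}`: the open set `U` contains the ray and a half-disk at `α` centred on
the ray, `φ` is holomorphic on `U`, and on the half-disk it is the sum of the series (powers of
`ζ - α` being those of direction `θ`). -/
def IsContinuationAlongRay (α : ℂ) (θ τ : ℝ) (b : ℕ → ℂ) (U : Set ℂ) (φ : ℂ → ℂ) : Prop :=
  IsOpen U ∧ openRay α θ ⊆ U ∧ DifferentiableOn ℂ φ U ∧
    ∃ r : ℝ, 0 < r ∧ ∀ ζ : ℂ, ‖ζ - α‖ < r →
      0 < (Complex.exp (-(θ * Complex.I)) * (ζ - α)).re →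
        ζ ∈ U ∧ HasSum (fun n : ℕ => b n * dirPow θ (ζ - α) (τ - 1 + n)) (φ ζ)

/-- The integrand of the Laplace transform of `φ` along the ray `α + e^{iθ}(0, ∞)`, in the
parameter `t` with `ζ = α + t e^{iθ}`, `dζ = e^{iθ} dt`. -/
def laplaceIntegrand (α : ℂ) (θ : ℝ) (φ : ℂ → ℂ) (z : ℂ) (t : ℝ) : ℂ :=
  Complex.exp (-(z * (α + t * Complex.exp (θ * Complex.I)))) *
    φ (α + t * Complex.exp (θ * Complex.I)) * Complex.exp (θ * Complex.I)

/-- The Laplace transform `∫ e^{-zζ} φ(ζ) dζ` along the ray `α + e^{iθ}(0, ∞)`. -/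
def laplace (α : ℂ) (θ : ℝ) (φ : ℂ → ℂ) (z : ℂ) : ℂ :=
  ∫ t in Set.Ioi (0 : ℝ), laplaceIntegrand α θ φ z t

/-- Borel regularity, in the direction `θ` and at the base point `α`, of a function `Φ` with
domain `D`, whose expansion is in the trans-monomial space `e^{-αz} z^{-τ} ℂ⟦z⁻¹⟧`. -/
structure IsBorelRegular (D : Set ℂ) (Φ : ℂ → ℂ) (θ : ℝ) (α : ℂ) (τ : ℝ) : Prop where
  /-- `Φ` has an asymptotic expansion, in the direction in which its Laplace integral decays. -/
  exists_expansion : ∃ c : ℕ → ℂ, HasAsymptoticExpansion D Φ (-θ) α τ c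
  /-- The Borel transform of the asymptotic expansion converges near `α`. -/
  borel_converges : ∀ c : ℕ → ℂ, HasAsymptoticExpansion D Φ (-θ) α τ c →
    ConvergesNearTip (borelCoeff τ c)
  /-- The sum continues analytically along the ray; its Laplace integral converges absolutely
  wherever `Φ` is defined, and gives back `Φ`. -/
  laplace_eq : ∀ c : ℕ → ℂ, HasAsymptoticExpansion D Φ (-θ) α τ c →
    ∃ (U : Set ℂ) (φ : ℂ → ℂ), IsContinuationAlongRay α θ τ (borelCoeff τ c) U φ ∧
      ∀ z ∈ D, IntegrableOn (laplaceIntegrand α θ φ z) (Set.Ioi 0) ∧ laplace α θ φ z = Φ z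

/-! ### Critical points, one-forms and thimbles on a one-dimensional complex manifold -/

section Manifold

variable {X : Type*} [TopologicalSpace X] [ChartedSpace ℂ X]

/-- `x` is a critical point of `f`. -/
def IsCriticalPoint (f : X → ℂ) (x : X) : Prop :=
  mfderiv 𝓘(ℂ) 𝓘(ℂ) f x = 0

/-- `x` is a non-degenerate critical point of `f`: the second derivative in a chart at `x` does
not vanish. -/
def IsNondegenerateCriticalPoint (f : X → ℂ) (x : X) : Prop :=
  IsCriticalPoint f x ∧
    iteratedDeriv 2 (f ∘ (extChartAt 𝓘(ℂ) x).symm) (extChartAt 𝓘(ℂ) x x) ≠ 0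

/-- A field `ν` of complex-linear forms on the tangent spaces is a holomorphic one-form: in each
chart it reads `g(w) dw` with `g` holomorphic. -/
def IsHolomorphicOneForm (ν : (x : X) → TangentSpace 𝓘(ℂ) x →L[ℂ] ℂ) : Prop :=
  ∀ x₀ : X, DifferentiableOn ℂ
    (fun w : ℂ => ν ((extChartAt 𝓘(ℂ) x₀).symm w)
      (mfderiv 𝓘(ℂ) 𝓘(ℂ) (extChartAt 𝓘(ℂ) x₀).symm w (1 : ℂ)))
    (extChartAt 𝓘(ℂ) x₀).target

/-- The connected component through `a` of the preimage of the ray that starts at `f a` in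
direction `θ`. -/
def thimble (f : X → ℂ) (a : X) (θ : ℝ) : Set X :=
  connectedComponentIn (f ⁻¹' ray (f a) θ) a

/-- The velocity of a curve in `X`, as a tangent vector. (The tangent spaces of `X` as a real and
as a complex manifold are the same space, with the same identification with `ℂ` through the
chart.) -/
def velocity (γ : ℝ → X) (s : ℝ) : TangentSpace 𝓘(ℂ) (γ s) :=
  (mfderiv 𝓘(ℝ, ℝ) 𝓘(ℝ, ℂ) γ s (1 : ℝ) : ℂ)

/-- The component through `a` of the preimage of the ray of direction `θ` is a Lefschetz thimble
`C`, and `γ : ℝ → X` is a regular parametrization of `C`, which also fixes its orientation: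
`a` is the only critical point on `C` and it is non-degenerate; `γ` is an injective `C¹` curve
with nowhere vanishing velocity, it passes through `a` at time `0` and its range is `C`;
both halves of `C` run out to infinity along the ray. -/
structure IsOrientedThimble (f : X → ℂ) (a : X) (θ : ℝ) (γ : ℝ → X) : Prop where
  nondegenerate : IsNondegenerateCriticalPoint f a
  eq_of_critical : ∀ x ∈ thimble f a θ, IsCriticalPoint f x → x = a
  contMDiff : ContMDiff 𝓘(ℝ, ℝ) 𝓘(ℝ, ℂ) 1 γ
  velocity_ne_zero : ∀ s, velocity γ s ≠ 0
  injective : Function.Injective γ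
  map_zero : γ 0 = a
  range_eq : Set.range γ = thimble f a θ
  tendsto_future : Tendsto (fun s => ‖f (γ s)‖) atTop atTop
  tendsto_past : Tendsto (fun s => ‖f (γ s)‖) atBot atTop

/-- The integrand of `∫ e^{-zf} ν` along the curve `γ`. -/
def thimbleIntegrand (f : X → ℂ) (ν : (x : X) → TangentSpace 𝓘(ℂ) x →L[ℂ] ℂ) (γ : ℝ → X)
    (z : ℂ) (s : ℝ) : ℂ :=
  Complex.exp (-(z * f (γ s))) * ν (γ s) (velocity γ s)

/-- The thimble integral converges absolutely at the frequency `z`. -/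
def ThimbleIntegrable (f : X → ℂ) (ν : (x : X) → TangentSpace 𝓘(ℂ) x →L[ℂ] ℂ) (γ : ℝ → X)
    (z : ℂ) : Prop :=
  Integrable (thimbleIntegrand f ν γ z)

/-- The thimble integral `I_a(z) = ∫ e^{-zf} ν`. -/
def thimbleIntegral (f : X → ℂ) (ν : (x : X) → TangentSpace 𝓘(ℂ) x →L[ℂ] ℂ) (γ : ℝ → X)
    (z : ℂ) : ℂ :=
  ∫ s : ℝ, thimbleIntegrand f ν γ z s

end Manifold

end Thimble

end

/-
Off the critical point, `ν / df` is a function on each half of the thimble, and the height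
`t = e^{-iθ} (f - f a)` is a parameter of that half. Pushing both halves to the `t`-line turns
`I_a (z)` into `e^{-f(a) z} e^{iθ}` times the Laplace transform, at `z e^{iθ}`, of the jump
`J t = A₊ t - A₋ t` between the values of `ν / df` on the two halves. In a Morse coordinate
`W ^ 2 = f - f a` the quotient `ν / df` reads `k (W) / W`, and the two halves are the two square
roots of `f - f a`, so that only the even part of `k` survives in the jump: `J t = t^{-1/2} G t`
with `G` holomorphic at `0`. Watson's lemma then gives the expansion, whose Borel transform is, by
uniqueness of asymptotic expansions, the series of `J`; and `J`, being real-analytic on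
`(0, ∞)`, extends holomorphically to a neighbourhood of the ray by gluing local extensions.
-/

noncomputable section

namespace Thimble

open Asymptotics Complex Metric Set Topology

theorem tendsto_ofReal_nhdsNE (t : ℝ) : Tendsto (fun s : ℝ => (s : ℂ)) (𝓝[≠] t) (𝓝[≠] (t : ℂ)) :=
  continuous_ofReal.continuousAt.continuousWithinAt.tendsto_nhdsWithin
    fun s hs => by simpa using hs

theorem exists_analyticAt_eventuallyEq_ofReal {J : ℝ → ℂ} {t : ℝ} (hJ : AnalyticAt ℝ J t) :
    ∃ ψ : ℂ → ℂ, AnalyticAt ℂ ψ t ∧ ∀ᶠ s : ℝ in 𝓝 t, J s = ψ s := by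
  obtain ⟨p, r, hp⟩ := hJ
  let q := FormalMultilinearSeries.ofScalars ℂ p.coeff
  have hr : r ≤ q.radius := hp.r_le.trans <| FormalMultilinearSeries.radius_le_of_le fun n => by
    rw [FormalMultilinearSeries.ofScalars_norm,
      FormalMultilinearSeries.norm_apply_eq_norm_coef]
  have hq : HasFPowerSeriesOnBall (fun z => q.sum (z - t)) q (0 + t) q.radius :=
    (q.hasFPowerSeriesOnBall (hp.r_pos.trans_le hr)).comp_sub (t : ℂ)
  rw [zero_add] at hq
  refine ⟨_, hq.analyticAt, ?_⟩
  filter_upwards [eball_mem_nhds t hp.r_pos] with s hs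
  have hs' : (s - t : ℂ) ∈ eball (0 : ℂ) q.radius := by
    rw [mem_eball, edist_eq_enorm_sub] at hs ⊢
    rw [sub_zero, ← ofReal_sub, ← enorm_norm, norm_real, enorm_norm]
    exact hs.trans_le hr
  refine (hp.hasSum_sub hs).unique ?_
  have hsum := q.hasSum hs'
  simp only [q, FormalMultilinearSeries.ofScalars_apply_eq] at hsum
  simpa only [FormalMultilinearSeries.apply_eq_pow_smul_coeff, real_smul, ofReal_pow, ofReal_sub,
    smul_eq_mul, mul_comm] using hsum

/-- `ψ` is a holomorphic extension of `J : ℝ → ℂ` to the convex open set `S`. Closing `S` under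
projection to the real axis makes any two such extensions agree on the intersection of their
domains. -/
structure IsExtensionPatch (J : ℝ → ℂ) (S : Set ℂ) (ψ : ℂ → ℂ) : Prop where
  isOpen : IsOpen S
  convex : Convex ℝ S
  re_mem : ∀ ζ ∈ S, (ζ.re : ℂ) ∈ S
  differentiableOn : DifferentiableOn ℂ ψ S
  eq_ofReal : ∀ t : ℝ, (t : ℂ) ∈ S → ψ t = J t

namespace IsExtensionPatch

variable {J : ℝ → ℂ} {S S' : Set ℂ} {ψ ψ' : ℂ → ℂ}

theorem eqOn_inter (h : IsExtensionPatch J S ψ) (h' : IsExtensionPatch J S' ψ') :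
    EqOn ψ ψ' (S ∩ S') := by
  intro ζ hζ
  have hopen : IsOpen (S ∩ S') := h.isOpen.inter h'.isOpen
  have hre : (ζ.re : ℂ) ∈ S ∩ S' := ⟨h.re_mem ζ hζ.1, h'.re_mem ζ hζ.2⟩
  refine AnalyticOnNhd.eqOn_of_preconnected_of_frequently_eq
    ((h.differentiableOn.mono inter_subset_left).analyticOnNhd hopen)
    ((h'.differentiableOn.mono inter_subset_right).analyticOnNhd hopen)
    (h.convex.inter h'.convex).isPreconnected hre ?_ hζ
  refine (tendsto_ofReal_nhdsNE ζ.re).frequently (Eventually.frequently ?_)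
  filter_upwards [((tendsto_ofReal_nhdsNE _).mono_right nhdsWithin_le_nhds).eventually
    (hopen.mem_nhds hre)] with t ht
  rw [h.eq_ofReal t ht.1, h'.eq_ofReal t ht.2]

theorem exists_of_analyticAt {t : ℝ} (hJ : AnalyticAt ℝ J t) :
    ∃ S ψ, IsExtensionPatch J S ψ ∧ (t : ℂ) ∈ S := by
  obtain ⟨ψ, hψ, hJψ⟩ := exists_analyticAt_eventuallyEq_ofReal hJ
  obtain ⟨r₁, hr₁, hψ⟩ := eventually_nhds_iff_ball.1 hψ.eventually_analyticAt
  obtain ⟨r₂, hr₂, hJψ⟩ := eventually_nhds_iff_ball.1 hJψ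
  have hre : ∀ ζ ∈ ball (t : ℂ) (min r₁ r₂), |ζ.re - t| < min r₁ r₂ := fun ζ hζ => by
    simpa using (abs_re_le_norm (ζ - t)).trans_lt (mem_ball_iff_norm.1 hζ)
  refine ⟨ball t (min r₁ r₂), ψ, ⟨isOpen_ball, convex_ball _ _, fun ζ hζ => ?_, fun ζ hζ => ?_,
    fun s hs => ?_⟩, mem_ball_self (lt_min hr₁ hr₂)⟩
  · rw [mem_ball, dist_eq_norm, ← ofReal_sub, norm_real]
    exact hre ζ hζ
  · exact (hψ ζ (ball_subset_ball (min_le_left _ _) hζ)).differentiableWithinAt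
  · exact (hJψ s ((hre s hs).trans_le (min_le_right _ _))).symm

theorem of_rpow_mul {τ r : ℝ} {G : ℂ → ℂ} (hG : DifferentiableOn ℂ G (ball 0 r))
    (hJ : ∀ t ∈ Ioo 0 r, J t = (t ^ (τ - 1) : ℝ) * G t) :
    IsExtensionPatch J (ball 0 r ∩ {ζ | 0 < ζ.re}) fun ζ => ζ ^ (τ - 1 : ℂ) * G ζ where
  isOpen := isOpen_ball.inter (isOpen_lt continuous_const continuous_re)
  convex := (convex_ball _ _).inter (convex_halfSpace_re_gt 0)
  re_mem ζ hζ := by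
    refine ⟨mem_ball_zero_iff.2 ?_, by simpa using hζ.2⟩
    rw [norm_real]
    exact (abs_re_le_norm ζ).trans_lt (mem_ball_zero_iff.1 hζ.1)
  differentiableOn ζ hζ :=
    ((differentiableAt_id.cpow_const (Or.inl hζ.2)).mul
      (hG.differentiableAt (isOpen_ball.mem_nhds hζ.1))).differentiableWithinAt
  eq_ofReal t ht := by
    have hpos : 0 < t := by simpa using ht.2
    have hlt : t < r := (le_abs_self t).trans_lt (by simpa using ht.1)
    rw [hJ t ⟨hpos, hlt⟩, ofReal_cpow hpos.le, ofReal_sub, ofReal_one]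

end IsExtensionPatch

/-- The union of the domains of all extension patches of `J`. -/
def extensionDomain (J : ℝ → ℂ) : Set ℂ :=
  {ζ | ∃ ψ S, IsExtensionPatch J S ψ ∧ ζ ∈ S}

open scoped Classical in
/-- The holomorphic function on `extensionDomain J` that the extension patches of `J` glue to; it is
`0` elsewhere. -/
def holomorphicExtension (J : ℝ → ℂ) (ζ : ℂ) : ℂ :=
  if h : ζ ∈ extensionDomain J then h.choose ζ else 0

section HolomorphicExtension

variable {J : ℝ → ℂ} {S : Set ℂ} {ψ : ℂ → ℂ}

theorem IsExtensionPatch.subset_extensionDomain (h : IsExtensionPatch J S ψ) :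
    S ⊆ extensionDomain J :=
  fun _ hζ => ⟨ψ, S, h, hζ⟩

theorem IsExtensionPatch.eqOn_holomorphicExtension (h : IsExtensionPatch J S ψ) :
    EqOn (holomorphicExtension J) ψ S := by
  intro ζ hζ
  have hmem := h.subset_extensionDomain hζ
  obtain ⟨S', h', hζ'⟩ := hmem.choose_spec
  rw [holomorphicExtension, dif_pos hmem]
  exact h'.eqOn_inter h ⟨hζ', hζ⟩

theorem isOpen_extensionDomain (J : ℝ → ℂ) : IsOpen (extensionDomain J) :=
  isOpen_iff_mem_nhds.2 fun _ ⟨_, _, h, hζ⟩ =>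
    mem_of_superset (h.isOpen.mem_nhds hζ) h.subset_extensionDomain

theorem differentiableOn_holomorphicExtension (J : ℝ → ℂ) :
    DifferentiableOn ℂ (holomorphicExtension J) (extensionDomain J) := fun _ ⟨_, _, h, hζ⟩ =>
  have hS := h.isOpen.mem_nhds hζ
  ((h.differentiableOn.differentiableAt hS).congr_of_eventuallyEq
    (h.eqOn_holomorphicExtension.eventuallyEq_of_mem hS)).differentiableWithinAt

theorem ofReal_mem_extensionDomain {t : ℝ} (hJ : AnalyticAt ℝ J t) :
    (t : ℂ) ∈ extensionDomain J :=
  have ⟨_, _, h, ht⟩ := IsExtensionPatch.exists_of_analyticAt hJ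
  h.subset_extensionDomain ht

theorem holomorphicExtension_ofReal {t : ℝ} (hJ : AnalyticAt ℝ J t) :
    holomorphicExtension J t = J t :=
  have ⟨_, _, h, ht⟩ := IsExtensionPatch.exists_of_analyticAt hJ
  (h.eqOn_holomorphicExtension ht).trans (h.eq_ofReal t ht)

end HolomorphicExtension

/-- The integral `∫ e^{-yt} J(t) dt` over the half-line `t > 0` converges absolutely. -/
def LaplaceIntegrableAt (J : ℝ → ℂ) (y : ℂ) : Prop :=
  IntegrableOn (fun t : ℝ => exp (-(y * t)) * J t) (Ioi 0)

/-- The Laplace integral `∫ e^{-yt} J(t) dt` over the half-line `t > 0`. -/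
def halfLineLaplace (J : ℝ → ℂ) (y : ℂ) : ℂ :=
  ∫ t in Ioi (0 : ℝ), exp (-(y * t)) * J t

theorem norm_exp_neg_mul_ofReal (y : ℂ) (t : ℝ) : ‖exp (-(y * t))‖ = Real.exp (-(y.re * t)) := by
  simp [norm_exp]

namespace LaplaceIntegrableAt

variable {J K : ℝ → ℂ} {y y₀ : ℂ}

theorem aestronglyMeasurable (h : LaplaceIntegrableAt J y₀) :
    AEStronglyMeasurable J (volume.restrict (Ioi 0)) := by
  have hexp : Continuous fun t : ℝ => exp (y₀ * t) := by fun_prop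
  refine (hexp.aestronglyMeasurable.mul (Integrable.aestronglyMeasurable h)).congr
    (Eventually.of_forall fun t => ?_)
  rw [Pi.mul_apply, ← mul_assoc, ← exp_add, add_neg_cancel, exp_zero, one_mul]

theorem mono_re (h : LaplaceIntegrableAt J y₀) (hy : y₀.re ≤ y.re) : LaplaceIntegrableAt J y := by
  have hexp : Continuous fun t : ℝ => exp (-(y * t)) := by fun_prop
  refine Integrable.mono h (hexp.aestronglyMeasurable.mul h.aestronglyMeasurable) ?_
  filter_upwards [ae_restrict_mem measurableSet_Ioi] with t (ht : 0 < t)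
  rw [norm_mul, norm_mul, norm_exp_neg_mul_ofReal, norm_exp_neg_mul_ofReal]
  gcongr

theorem const_mul (c : ℂ) (h : LaplaceIntegrableAt J y) :
    LaplaceIntegrableAt (fun t => c * J t) y :=
  (Integrable.const_mul h c).congr (Eventually.of_forall fun t => by ring)

theorem sub (hJ : LaplaceIntegrableAt J y) (hK : LaplaceIntegrableAt K y) :
    LaplaceIntegrableAt (fun t => J t - K t) y :=
  (Integrable.sub hJ hK).congr (Eventually.of_forall fun t => by simp only [Pi.sub_apply, mul_sub])

theorem finset_sum {ι : Type*} {s : Finset ι} {F : ι → ℝ → ℂ}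
    (h : ∀ i ∈ s, LaplaceIntegrableAt (F i) y) :
    LaplaceIntegrableAt (fun t => ∑ i ∈ s, F i t) y :=
  (integrable_finsetSum s h).congr (Eventually.of_forall fun t => by simp only [Finset.mul_sum])

end LaplaceIntegrableAt

section HalfLineLaplace

variable {J K : ℝ → ℂ} {y y₀ : ℂ}

theorem halfLineLaplace_const_mul (c : ℂ) (J : ℝ → ℂ) (y : ℂ) :
    halfLineLaplace (fun t => c * J t) y = c * halfLineLaplace J y := by
  simp only [halfLineLaplace, ← integral_const_mul, mul_left_comm]

theorem halfLineLaplace_sub (hJ : LaplaceIntegrableAt J y) (hK : LaplaceIntegrableAt K y) :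
    halfLineLaplace (fun t => J t - K t) y = halfLineLaplace J y - halfLineLaplace K y := by
  simp only [halfLineLaplace, mul_sub]
  exact integral_sub hJ hK

theorem halfLineLaplace_finset_sum {ι : Type*} {s : Finset ι} {F : ι → ℝ → ℂ}
    (h : ∀ i ∈ s, LaplaceIntegrableAt (F i) y) :
    halfLineLaplace (fun t => ∑ i ∈ s, F i t) y = ∑ i ∈ s, halfLineLaplace (F i) y := by
  simp only [halfLineLaplace, Finset.mul_sum]
  exact integral_finsetSum s h

theorem mul_exp_neg_mul_le {ε t : ℝ} (hε : 0 < ε) : t * Real.exp (-(ε * t)) ≤ ε⁻¹ := by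
  have h : ε * t ≤ Real.exp (ε * t) := by linarith [Real.add_one_le_exp (ε * t)]
  rw [Real.exp_neg, ← div_eq_mul_inv, div_le_iff₀ (Real.exp_pos _)]
  calc t = ε⁻¹ * (ε * t) := by field_simp
    _ ≤ ε⁻¹ * Real.exp (ε * t) := by gcongr

theorem differentiableAt_halfLineLaplace (h : LaplaceIntegrableAt J y₀) (hy : y₀.re < y.re) :
    DifferentiableAt ℂ (halfLineLaplace J) y := by
  obtain ⟨x, hx₀, hx⟩ := exists_between hy
  have hmem : {w : ℂ | x < w.re} ∈ 𝓝 y :=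
    (isOpen_lt continuous_const continuous_re).mem_nhds hx
  have hexp (w : ℂ) : Continuous fun t : ℝ => exp (-(w * t)) := by fun_prop
  have hexp' : Continuous fun t : ℝ => -(t : ℂ) * exp (-(y * t)) := by fun_prop
  refine (hasDerivAt_integral_of_dominated_loc_of_deriv_le
    (F := fun (w : ℂ) (t : ℝ) => exp (-(w * t)) * J t)
    (F' := fun (w : ℂ) (t : ℝ) => (-(t : ℂ) * exp (-(w * t))) * J t)
    (bound := fun t : ℝ => (x - y₀.re)⁻¹ * ‖exp (-(y₀ * t)) * J t‖) hmem
    (Eventually.of_forall fun w => (hexp w).aestronglyMeasurable.mul h.aestronglyMeasurable)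
    (h.mono_re hy.le) (hexp'.aestronglyMeasurable.mul h.aestronglyMeasurable) ?_
    (Integrable.const_mul (Integrable.norm h) _) ?_).2.differentiableAt
  · filter_upwards [ae_restrict_mem measurableSet_Ioi] with t (ht : 0 < t) w (hw : x < w.re)
    rw [norm_mul, norm_mul, norm_mul, norm_exp_neg_mul_ofReal, norm_exp_neg_mul_ofReal, norm_neg,
      norm_real, Real.norm_of_nonneg ht.le, ← mul_assoc]
    refine mul_le_mul_of_nonneg_right ?_ (norm_nonneg _)
    calc t * Real.exp (-(w.re * t)) ≤ t * Real.exp (-(x * t)) := by gcongr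
      _ = t * Real.exp (-((x - y₀.re) * t)) * Real.exp (-(y₀.re * t)) := by
        rw [mul_assoc, ← Real.exp_add]; ring_nf
      _ ≤ (x - y₀.re)⁻¹ * Real.exp (-(y₀.re * t)) := by
        gcongr; exact mul_exp_neg_mul_le (sub_pos.2 hx₀)
  · filter_upwards with t w _
    convert! ((hasDerivAt_mul_const (t : ℂ)).fun_neg (x := w)).cexp.mul_const (J t) using 1
    ring

theorem integrableOn_rpow_mul_exp_neg_mul {σ x : ℝ} (hσ : 0 < σ) (hx : 0 < x) :
    IntegrableOn (fun t : ℝ => t ^ (σ - 1) * Real.exp (-(x * t))) (Ioi 0) := by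
  have h := integrableOn_rpow_mul_exp_neg_mul_rpow (p := 1) (s := σ - 1) (by linarith) one_pos hx
  simpa only [Real.rpow_one, neg_mul] using h

theorem laplaceIntegrableAt_rpow {σ : ℝ} (hσ : 0 < σ) (hy : 0 < y.re) :
    LaplaceIntegrableAt (fun t => (t ^ (σ - 1) : ℝ)) y := by
  have hre : LaplaceIntegrableAt (fun t => (t ^ (σ - 1) : ℝ)) (y.re : ℂ) :=
    (integrableOn_rpow_mul_exp_neg_mul hσ hy).ofReal.congr (Eventually.of_forall fun t => by
      simp [mul_comm])
  exact hre.mono_re (by simp)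

theorem halfLineLaplace_rpow {σ : ℝ} (hσ : 0 < σ) (hy : 0 < y.re) :
    halfLineLaplace (fun t => ((t ^ (σ - 1) : ℝ) : ℂ)) y = Real.Gamma σ * y ^ (-(σ : ℂ)) := by
  have hopen : IsOpen {y : ℂ | 0 < y.re} := isOpen_lt continuous_const continuous_re
  refine AnalyticOnNhd.eqOn_of_preconnected_of_frequently_eq (U := {y : ℂ | 0 < y.re})
    (z₀ := (1 : ℝ)) (DifferentiableOn.analyticOnNhd (fun w (hw : 0 < w.re) => ?_) hopen)
    (g := fun y : ℂ => Real.Gamma σ * y ^ (-(σ : ℂ)))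
    (DifferentiableOn.analyticOnNhd (fun w (hw : 0 < w.re) => ?_) hopen)
    (convex_halfSpace_re_gt 0).isPreconnected (by simp)
    ((tendsto_ofReal_nhdsNE 1).frequently (Eventually.frequently ?_)) hy
  · have hhalf : 0 < ((w.re / 2 : ℝ) : ℂ).re := half_pos hw
    exact (differentiableAt_halfLineLaplace (laplaceIntegrableAt_rpow hσ hhalf)
      (half_lt_self hw)).differentiableWithinAt
  · exact ((differentiableAt_id.cpow_const (Or.inl hw)).const_mul _).differentiableWithinAt
  · filter_upwards [nhdsWithin_le_nhds (Ioi_mem_nhds one_pos)] with r (hr : 0 < r)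
    have hΓ := integral_cpow_mul_exp_neg_mul_Ioi (a := σ) (r := r) (by simpa using hσ) hr
    rw [one_div, inv_cpow _ _ (by rw [arg_ofReal_of_nonneg hr.le]; exact Real.pi_pos.ne),
      ← cpow_neg, mul_comm, Gamma_ofReal] at hΓ
    rw [← hΓ]
    refine setIntegral_congr_fun measurableSet_Ioi fun t (ht : 0 < t) => ?_
    simp only [ofReal_cpow ht.le, ofReal_sub, ofReal_one, mul_comm]

theorem norm_halfLineLaplace_le {g : ℝ → ℂ} {r C σ : ℝ} (hσ : 0 < σ) (hC : 0 ≤ C)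
    (hint : LaplaceIntegrableAt g y₀) (hg : ∀ t ∈ Ioo 0 r, ‖g t‖ ≤ C * t ^ (σ - 1))
    (hy : 0 < y.re) (hle : y₀.re ≤ y.re) :
    ‖halfLineLaplace g y‖ ≤ C * ((1 / y.re) ^ σ * Real.Gamma σ) +
      Real.exp (-((y.re - y₀.re) * r)) * ∫ t in Ioi (0 : ℝ), ‖exp (-(y₀ * t)) * g t‖ := by
  have hpow := (integrableOn_rpow_mul_exp_neg_mul hσ hy).const_mul C
  have htail := (Integrable.norm hint).const_mul (Real.exp (-((y.re - y₀.re) * r)))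
  rw [← Real.integral_rpow_mul_exp_neg_mul_Ioi hσ hy, ← integral_const_mul, ← integral_const_mul,
    ← integral_add hpow htail]
  refine norm_integral_le_of_norm_le (hpow.add htail) ?_
  filter_upwards [ae_restrict_mem measurableSet_Ioi] with t (ht : 0 < t)
  simp only [norm_mul, norm_exp_neg_mul_ofReal]
  rcases lt_or_ge t r with htr | htr
  · refine le_add_of_le_of_nonneg ?_ (by positivity)
    calc Real.exp (-(y.re * t)) * ‖g t‖ ≤ Real.exp (-(y.re * t)) * (C * t ^ (σ - 1)) := by
          gcongr; exact hg t ⟨ht, htr⟩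
      _ = C * (t ^ (σ - 1) * Real.exp (-(y.re * t))) := by ring
  · refine le_add_of_nonneg_of_le (by positivity) ?_
    have hexp : Real.exp (-(y.re * t)) ≤
        Real.exp (-((y.re - y₀.re) * r)) * Real.exp (-(y₀.re * t)) := by
      rw [← Real.exp_add, Real.exp_le_exp]
      nlinarith [mul_nonneg (sub_nonneg.2 hle) (sub_nonneg.2 htr)]
    rw [← mul_assoc]
    gcongr

theorem halfLineLaplace_isBigO {g : ℝ → ℂ} {σ : ℝ} (hσ : 0 < σ) (hint : LaplaceIntegrableAt g y₀)
    (hg : g =O[𝓝[>] 0] fun t : ℝ => t ^ (σ - 1)) {ω : ℂ} (hω : 0 < ω.re) :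
    (fun ρ : ℝ => halfLineLaplace g (ρ * ω)) =O[atTop] fun ρ : ℝ => ρ ^ (-σ) := by
  obtain ⟨C, hC, hg⟩ := hg.exists_nonneg
  obtain ⟨r, hr : 0 < r, hg⟩ := mem_nhdsGT_iff_exists_Ioo_subset.1 hg.bound
  replace hg : ∀ t ∈ Ioo 0 r, ‖g t‖ ≤ C * t ^ (σ - 1) := fun t ht =>
    (hg ht).trans_eq (by rw [Real.norm_of_nonneg (Real.rpow_nonneg ht.1.le _)])
  set M := ∫ t in Ioi (0 : ℝ), ‖exp (-(y₀ * t)) * g t‖ with hM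
  have hpow : (fun ρ : ℝ => C * ((1 / ω.re) ^ σ * Real.Gamma σ) * ρ ^ (-σ)) =O[atTop]
      fun ρ : ℝ => ρ ^ (-σ) := isBigO_const_mul_self _ _ _
  have htail : (fun ρ : ℝ => Real.exp (y₀.re * r) * M * Real.exp (-(ω.re * r) * ρ)) =O[atTop]
      fun ρ : ℝ => ρ ^ (-σ) :=
    (isLittleO_exp_neg_mul_rpow_atTop (mul_pos hω hr) (-σ)).isBigO.const_mul_left _
  refine (IsBigO.of_norm_eventuallyLE ?_).trans (hpow.add htail)
  have hlim : Tendsto (fun ρ : ℝ => ρ * ω.re) atTop atTop := tendsto_id.atTop_mul_const hω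
  filter_upwards [eventually_gt_atTop 0, hlim.eventually_ge_atTop y₀.re] with ρ hρ hρy
  have hre : ((ρ : ℂ) * ω).re = ρ * ω.re := by simp
  refine (norm_halfLineLaplace_le hσ hC hint hg (hre ▸ by positivity) (hre ▸ hρy)).trans_eq ?_
  have hexp : Real.exp (-((ρ * ω.re - y₀.re) * r)) =
      Real.exp (y₀.re * r) * Real.exp (-(ω.re * r) * ρ) := by
    rw [← Real.exp_add]; ring_nf
  rw [hre, ← hM, hexp, one_div, mul_inv, Real.mul_rpow (by positivity) (by positivity),
    Real.inv_rpow hρ.le, ← Real.rpow_neg hρ.le, one_div]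
  ring

/-- Watson's lemma. -/
theorem halfLineLaplace_sub_sum_isBigO {τ : ℝ} (hτ : 0 < τ) (hJ : LaplaceIntegrableAt J y₀)
    {e : ℕ → ℂ} {n : ℕ}
    (hrem : (fun t : ℝ => J t - ∑ k ∈ Finset.range n, e k * (t ^ (τ + k - 1) : ℝ)) =O[𝓝[>] 0]
      fun t : ℝ => t ^ (τ + n - 1)) {ω : ℂ} (hω : 0 < ω.re) :
    (fun ρ : ℝ => halfLineLaplace J (ρ * ω) -
        ∑ k ∈ Finset.range n, e k * (Real.Gamma (τ + k) * (ρ * ω) ^ (-(τ + k : ℝ) : ℂ))) =O[atTop]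
      fun ρ : ℝ => ρ ^ (-(τ + n)) := by
  have hpos (k : ℕ) : 0 < τ + k := by positivity
  have hterm {y : ℂ} (hy : 0 < y.re) : ∀ k ∈ Finset.range n,
      LaplaceIntegrableAt (fun t => e k * (t ^ (τ + k - 1) : ℝ)) y := fun k _ =>
    (laplaceIntegrableAt_rpow (hpos k) hy).const_mul (e k)
  have hmax : 0 < ((max y₀.re 1 : ℝ) : ℂ).re := by simp
  refine (halfLineLaplace_isBigO (hpos n) ((hJ.mono_re (le_max_left _ _)).sub
    (.finset_sum (hterm hmax))) hrem hω).congr' ?_ .rfl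
  have hlim : Tendsto (fun ρ : ℝ => ρ * ω.re) atTop atTop := tendsto_id.atTop_mul_const hω
  filter_upwards [hlim.eventually_gt_atTop 0, hlim.eventually_ge_atTop y₀.re] with ρ hρ hρy
  have hre : ((ρ : ℂ) * ω).re = ρ * ω.re := by simp
  rw [halfLineLaplace_sub (hJ.mono_re (hre ▸ hρy)) (.finset_sum (hterm (hre ▸ hρ))),
    halfLineLaplace_finset_sum (hterm (hre ▸ hρ))]
  congr 1
  exact Finset.sum_congr rfl fun k _ => by
    rw [halfLineLaplace_const_mul, halfLineLaplace_rpow (hpos k) (hre ▸ hρ)]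

theorem sub_sum_isBigO_of_hasFPowerSeriesAt {τ : ℝ} {G : ℂ → ℂ}
    {p : FormalMultilinearSeries ℂ ℂ ℂ} (hG : HasFPowerSeriesAt G p 0)
    (hJ : ∀ᶠ t : ℝ in 𝓝[>] 0, J t = (t ^ (τ - 1) : ℝ) * G t) (n : ℕ) :
    (fun t : ℝ => J t - ∑ k ∈ Finset.range n, p.coeff k * (t ^ (τ + k - 1) : ℝ)) =O[𝓝[>] 0]
      fun t : ℝ => t ^ (τ + n - 1) := by
  have hofReal : Tendsto (fun t : ℝ => (t : ℂ)) (𝓝[>] 0) (𝓝 0) :=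
    (continuous_ofReal.tendsto' 0 0 ofReal_zero).mono_left nhdsWithin_le_nhds
  have hsub := (hG.isBigO_sub_partialSum_pow n).comp_tendsto hofReal
  refine ((isBigO_ofReal_left.2 (isBigO_refl (fun t : ℝ => t ^ (τ - 1)) (𝓝[>] 0))).mul hsub).congr'
    ?_ ?_
  · filter_upwards [hJ, self_mem_nhdsWithin] with t ht (hpos : 0 < t)
    simp only [Function.comp_apply, zero_add, FormalMultilinearSeries.partialSum,
      FormalMultilinearSeries.apply_eq_pow_smul_coeff, smul_eq_mul]
    rw [ht, mul_sub, Finset.mul_sum]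
    congr 1
    refine Finset.sum_congr rfl fun k _ => ?_
    rw [add_sub_right_comm, Real.rpow_add_natCast hpos.ne', ofReal_mul, ofReal_pow]
    ring
  · filter_upwards [self_mem_nhdsWithin] with t (hpos : 0 < t)
    simp only [Function.comp_apply, norm_real, Real.norm_of_nonneg hpos.le]
    rw [add_sub_right_comm, Real.rpow_add_natCast hpos.ne']

end HalfLineLaplace

theorem norm_dirPow (β : ℝ) (u : ℂ) (σ : ℝ) : ‖dirPow β u σ‖ = ‖u‖ ^ σ := by
  have hrot : ‖exp (-(β * I)) * u‖ = ‖u‖ := by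
    rw [norm_mul, ← neg_mul, ← ofReal_neg, norm_exp_ofReal_mul_I, one_mul]
  rw [dirPow, norm_mul, ← ofReal_mul, norm_exp_ofReal_mul_I, one_mul,
    norm_cpow_real, hrot]

theorem dirPow_ne_zero (β : ℝ) {u : ℂ} (hu : u ≠ 0) (σ : ℝ) : dirPow β u σ ≠ 0 := by
  rw [← norm_ne_zero_iff, norm_dirPow]
  exact (Real.rpow_pos_of_pos (norm_pos_iff.2 hu) _).ne'

theorem HasAsymptoticExpansion.unique {D : Set ℂ} {Φ : ℂ → ℂ} {β : ℝ} {α : ℂ} {τ : ℝ}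
    {c c' : ℕ → ℂ} (h : HasAsymptoticExpansion D Φ β α τ c)
    (h' : HasAsymptoticExpansion D Φ β α τ c') : c = c' := by
  obtain ⟨δ, -, hδ, -, -, -, -, h⟩ := h
  obtain ⟨δ', -, hδ', -, -, -, -, h'⟩ := h'
  funext n
  induction n using Nat.strong_induction_on with
  | _ n ih =>
  have hdiff := (h' 0 (by simpa using hδ') n).sub (h 0 (by simpa using hδ) n)
  set z : ℝ → ℂ := fun ρ => ρ * exp ((β + 0 : ℝ) * I)
  set X : ℝ → ℂ := fun ρ => exp (-(α * z ρ)) * dirPow β (z ρ) (-τ - n) with hX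
  have hlead : (fun ρ => (c n - c' n) * X ρ) =o[atTop] X := by
    refine hdiff.congr_left fun ρ => ?_
    rw [Finset.sum_range_succ, Finset.sum_range_succ,
      Finset.sum_congr rfl fun k hk => by rw [← ih k (Finset.mem_range.1 hk)]]
    simp only [hX]
    ring
  by_contra hne
  refine isLittleO_irrefl (Eventually.frequently ?_)
    ((isLittleO_const_mul_left_iff (sub_ne_zero.2 hne)).1 hlead)
  filter_upwards [eventually_gt_atTop 0] with ρ hρ
  exact mul_ne_zero (exp_ne_zero _) (dirPow_ne_zero _
    (mul_ne_zero (ofReal_ne_zero.2 hρ.ne') (exp_ne_zero _)) _)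

/-- The coefficients of the asymptotic expansion of the Laplace integral, along the ray of
direction `θ`, of a function of `ζ = α + t e^{iθ}` with the expansion `∑ e n t^{τ - 1 + n}` as
`t → 0`. -/
def expansionCoeff (θ τ : ℝ) (e : ℕ → ℂ) (n : ℕ) : ℂ :=
  e n * Real.Gamma (τ + n) * exp (θ * (1 - τ - n) * I)

theorem borelCoeff_expansionCoeff (θ : ℝ) {τ : ℝ} (hτ : 0 < τ) (e : ℕ → ℂ) (n : ℕ) :
    borelCoeff τ (expansionCoeff θ τ e) n = e n * exp (θ * (1 - τ - n) * I) := by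
  have hΓ : (Real.Gamma (τ + n) : ℂ) ≠ 0 :=
    ofReal_ne_zero.2 (Real.Gamma_pos_of_pos (by positivity)).ne'
  rw [borelCoeff, expansionCoeff, div_eq_iff hΓ]
  ring

theorem expansionCoeff_mul_dirPow (θ τ : ℝ) (e : ℕ → ℂ) (n : ℕ) (z : ℂ) :
    expansionCoeff θ τ e n * dirPow (-θ) z (-τ - n) =
      exp (θ * I) * (e n * (Real.Gamma (τ + n) * (z * exp (θ * I)) ^ (-(τ + n : ℝ) : ℂ))) := by
  have hphase : exp (θ * (1 - τ - n) * I) * exp ((-θ : ℝ) * (-τ - n : ℝ) * I) = exp (θ * I) := by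
    rw [← exp_add]; push_cast; ring_nf
  have hrot : exp (-((-θ : ℝ) * I)) * z = z * exp (θ * I) := by
    rw [mul_comm, ofReal_neg, neg_mul, neg_neg]
  have hpow : ((-τ - n : ℝ) : ℂ) = -(τ + n : ℝ) := by push_cast; ring
  rw [dirPow, expansionCoeff, hrot, ← hphase, hpow]
  ring

theorem borelCoeff_mul_dirPow (θ : ℝ) {τ : ℝ} (hτ : 0 < τ) (e : ℕ → ℂ) (n : ℕ) {u : ℂ}
    (hu : u ≠ 0) :
    borelCoeff τ (expansionCoeff θ τ e) n * dirPow θ u (τ - 1 + n) =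
      (exp (-(θ * I)) * u) ^ (τ - 1 : ℂ) * (e n * (exp (-(θ * I)) * u) ^ n) := by
  have hphase : exp (θ * (1 - τ - n) * I) * exp (θ * (τ - 1 + n : ℝ) * I) = 1 := by
    rw [← exp_add, exp_eq_one_iff]
    exact ⟨0, by push_cast; ring⟩
  rw [borelCoeff_expansionCoeff θ hτ, dirPow, ofReal_add, ofReal_natCast,
    cpow_add _ _ (mul_ne_zero (exp_ne_zero _) hu), cpow_natCast, ofReal_sub, ofReal_one]
  push_cast at hphase
  linear_combination (e n * ((exp (-(θ * I)) * u) ^ (τ - 1 : ℂ) *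
    (exp (-(θ * I)) * u) ^ n)) * hphase

theorem convergesNearTip_expansionCoeff (θ : ℝ) {τ : ℝ} (hτ : 0 < τ) {G : ℂ → ℂ}
    {p : FormalMultilinearSeries ℂ ℂ ℂ} (hG : HasFPowerSeriesAt G p 0) :
    ConvergesNearTip (borelCoeff τ (expansionCoeff θ τ p.coeff)) := by
  obtain ⟨r, hr, hr'⟩ := ENNReal.lt_iff_exists_nnreal_btwn.1 hG.radius_pos
  refine ⟨r, by exact_mod_cast hr, (p.summable_norm_mul_pow hr').congr fun n => ?_⟩
  have hphase := norm_exp_ofReal_mul_I (θ * (1 - τ - n))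
  push_cast at hphase
  rw [borelCoeff_expansionCoeff θ hτ, norm_mul, hphase, mul_one,
    FormalMultilinearSeries.norm_apply_eq_norm_coef]

theorem rotate_ray_point (α : ℂ) (θ t : ℝ) :
    exp (-(θ * I)) * (α + t * exp (θ * I) - α) = t := by
  rw [add_sub_cancel_left, mul_left_comm, ← exp_add, neg_add_cancel, exp_zero, mul_one]

theorem isContinuationAlongRay_holomorphicExtension (α : ℂ) (θ : ℝ) {τ : ℝ} (hτ : 0 < τ)
    {J : ℝ → ℂ} (hJ : AnalyticOnNhd ℝ J (Ioi 0)) {G : ℂ → ℂ}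
    {p : FormalMultilinearSeries ℂ ℂ ℂ} (hG : HasFPowerSeriesAt G p 0)
    (hJG : ∀ᶠ t : ℝ in 𝓝[>] 0, J t = (t ^ (τ - 1) : ℝ) * G t) :
    IsContinuationAlongRay α θ τ (borelCoeff τ (expansionCoeff θ τ p.coeff))
      ((fun ζ => exp (-(θ * I)) * (ζ - α)) ⁻¹' extensionDomain J)
      fun ζ => holomorphicExtension J (exp (-(θ * I)) * (ζ - α)) := by
  have hrot : Differentiable ℂ fun ζ : ℂ => exp (-(θ * I)) * (ζ - α) := by fun_prop
  refine ⟨(isOpen_extensionDomain J).preimage hrot.continuous, ?_,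
    (differentiableOn_holomorphicExtension J).comp hrot.differentiableOn fun _ hζ => hζ, ?_⟩
  · rintro _ ⟨t, ht, rfl⟩
    rw [mem_preimage, rotate_ray_point]
    exact ofReal_mem_extensionDomain (hJ t ht)
  obtain ⟨r₁, hr₁, hG'⟩ := eventually_nhds_iff_ball.1 hG.analyticAt.eventually_analyticAt
  obtain ⟨r₂, hr₂, hsum⟩ := eventually_nhds_iff_ball.1 (hasFPowerSeriesAt_iff.1 hG)
  obtain ⟨r₃, hr₃ : 0 < r₃, hJG⟩ := mem_nhdsGT_iff_exists_Ioo_subset.1 hJG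
  have hpatch : IsExtensionPatch J (ball 0 (min r₁ r₃) ∩ {ζ | 0 < ζ.re}) _ :=
    .of_rpow_mul (τ := τ) (G := G)
      (fun ζ hζ => (hG' ζ (ball_subset_ball (min_le_left _ _)
        hζ)).differentiableAt.differentiableWithinAt)
      fun t ht => hJG ⟨ht.1, ht.2.trans_le (min_le_right _ _)⟩
  refine ⟨min (min r₁ r₃) r₂, lt_min (lt_min hr₁ hr₃) hr₂, fun ζ hζ hre => ?_⟩
  have hnorm : ‖exp (-(θ * I)) * (ζ - α)‖ = ‖ζ - α‖ := by
    rw [norm_mul, ← neg_mul, ← ofReal_neg, norm_exp_ofReal_mul_I, one_mul]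
  have hmem : exp (-(θ * I)) * (ζ - α) ∈ ball 0 (min r₁ r₃) ∩ {ζ | 0 < ζ.re} :=
    ⟨mem_ball_zero_iff.2 (hnorm.trans_lt (hζ.trans_le (min_le_left _ _))), hre⟩
  have hζα : ζ - α ≠ 0 := fun h => by simp [h] at hre
  refine ⟨hpatch.subset_extensionDomain hmem, ?_⟩
  simp only [borelCoeff_mul_dirPow θ hτ _ _ hζα, hpatch.eqOn_holomorphicExtension hmem]
  have hseries := hsum _ (mem_ball_zero_iff.2 (hnorm.trans_lt (hζ.trans_le (min_le_right _ _))))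
  simp only [smul_eq_mul, zero_add, mul_comm (_ ^ (_ : ℕ))] at hseries
  exact hseries.mul_left _

/-- On `D`, the function `Φ` is the absolutely convergent Laplace integral
`∫ e^{-zζ} J(t) dζ` along the ray `ζ = α + t e^{iθ}`, `t > 0`. The condition on `D` makes it a
half-plane: convergence depends only on the real part of `z e^{iθ}`. -/
structure IsRayLaplaceTransform (D : Set ℂ) (Φ : ℂ → ℂ) (θ : ℝ) (α : ℂ) (J : ℝ → ℂ) : Prop where
  mem_of_re_le : ∀ z ∈ D, ∀ z', (z * exp (θ * I)).re ≤ (z' * exp (θ * I)).re → z' ∈ D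
  integrableAt : ∀ z ∈ D, LaplaceIntegrableAt J (z * exp (θ * I))
  eq_laplace : ∀ z ∈ D,
    Φ z = exp (-(α * z)) * exp (θ * I) * halfLineLaplace J (z * exp (θ * I))

theorem isLittleO_rpow_rpow_atTop {a b : ℝ} (hab : a < b) :
    (fun x : ℝ => x ^ a) =o[atTop] fun x : ℝ => x ^ b := by
  have hquot : Tendsto (fun x : ℝ => x ^ (-(b - a))) atTop (𝓝 0) :=
    tendsto_rpow_neg_atTop (sub_pos.2 hab)
  refine (isLittleO_iff_tendsto' ?_).2 (hquot.congr' ?_)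
  · filter_upwards [eventually_gt_atTop 0] with x hx h0
    exact absurd h0 (Real.rpow_pos_of_pos hx _).ne'
  · filter_upwards [eventually_gt_atTop 0] with x hx
    rw [neg_sub, Real.rpow_sub hx]

theorem mul_exp_rotate (θ ψ ρ : ℝ) :
    ρ * exp ((-θ + ψ : ℝ) * I) * exp (θ * I) = ρ * exp (ψ * I) := by
  rw [mul_assoc, ← exp_add]; push_cast; ring_nf

theorem half_lt_cos {ψ : ℝ} (hψ : |ψ| < Real.pi / 3) : 1 / 2 < Real.cos ψ := by
  rw [← Real.cos_abs ψ, ← Real.cos_pi_div_three]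
  exact Real.cos_lt_cos_of_nonneg_of_le_pi (abs_nonneg _) (by linarith [Real.pi_pos]) hψ

theorem lt_re_of_mem_sectorAtInfty {θ x : ℝ} (hx : 0 < x) {z : ℂ}
    (hz : z ∈ sectorAtInfty (-θ) (Real.pi / 3) (2 * x)) : x < (z * exp (θ * I)).re := by
  obtain ⟨ρ, ψ, hρ, hψ, rfl⟩ := hz
  rw [mul_exp_rotate, re_ofReal_mul, exp_ofReal_mul_I_re]
  nlinarith [half_lt_cos hψ]

namespace IsRayLaplaceTransform

variable {D : Set ℂ} {Φ : ℂ → ℂ} {θ τ : ℝ} {α z z₀ : ℂ} {J : ℝ → ℂ}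

theorem differentiableAt (h : IsRayLaplaceTransform D Φ θ α J) (hz₀ : z₀ ∈ D)
    (hz : (z₀ * exp (θ * I)).re < (z * exp (θ * I)).re) : DifferentiableAt ℂ Φ z := by
  have hnhds : {w : ℂ | (z₀ * exp (θ * I)).re < (w * exp (θ * I)).re} ∈ 𝓝 z :=
    (isOpen_lt continuous_const (by fun_prop)).mem_nhds hz
  have hlaplace : DifferentiableAt ℂ (fun w => halfLineLaplace J (w * exp (θ * I))) z :=
    DifferentiableAt.comp (g := halfLineLaplace J) z
      (differentiableAt_halfLineLaplace (h.integrableAt z₀ hz₀) hz) (by fun_prop)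
  have hfactor : DifferentiableAt ℂ (fun w => exp (-(α * w)) * exp (θ * I)) z := by fun_prop
  refine (hfactor.mul hlaplace).congr_of_eventuallyEq ?_
  filter_upwards [hnhds] with w (hw : _ < _)
  exact h.eq_laplace w (h.mem_of_re_le z₀ hz₀ w hw.le)

theorem isLittleO (h : IsRayLaplaceTransform D Φ θ α J) (hD : D.Nonempty) (hτ : 0 < τ) {e : ℕ → ℂ}
    {n : ℕ}
    (hrem : (fun t : ℝ => J t - ∑ k ∈ Finset.range (n + 1), e k * (t ^ (τ + k - 1) : ℝ)) =O[𝓝[>] 0]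
      fun t : ℝ => t ^ (τ + (n + 1 : ℕ) - 1)) {ψ : ℝ} (hψ : 0 < Real.cos ψ) {z : ℝ → ℂ}
    (hz : ∀ ρ : ℝ, z ρ = ρ * exp ((-θ + ψ : ℝ) * I)) :
    (fun ρ : ℝ => Φ (z ρ) - exp (-(α * z ρ)) *
        ∑ k ∈ Finset.range (n + 1), expansionCoeff θ τ e k * dirPow (-θ) (z ρ) (-τ - k))
      =o[atTop] fun ρ : ℝ => exp (-(α * z ρ)) * dirPow (-θ) (z ρ) (-τ - n) := by
  obtain ⟨z₀, hz₀⟩ := hD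
  have hω : 0 < (exp (ψ * I)).re := by rwa [exp_ofReal_mul_I_re]
  have hwatson := (halfLineLaplace_sub_sum_isBigO hτ (h.integrableAt z₀ hz₀) hrem
    hω).trans_isLittleO (isLittleO_rpow_rpow_atTop (b := -τ - n) (by push_cast; linarith))
  have hdir : (fun ρ : ℝ => ρ ^ (-τ - n)) =O[atTop] fun ρ => dirPow (-θ) (z ρ) (-τ - n) := by
    refine IsBigO.of_bound' ?_
    filter_upwards [eventually_gt_atTop 0] with ρ hρ
    rw [norm_dirPow, hz, norm_mul, norm_exp_ofReal_mul_I, mul_one, norm_real,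
      Real.norm_of_nonneg hρ.le, Real.norm_of_nonneg (Real.rpow_nonneg hρ.le _)]
  refine ((isBigO_refl (fun ρ => exp (-(α * z ρ))) atTop).mul_isLittleO
    ((hwatson.trans_isBigO hdir).const_mul_left (exp (θ * I)))).congr' ?_ .rfl
  have hlim : Tendsto (fun ρ : ℝ => ρ * Real.cos ψ) atTop atTop := tendsto_id.atTop_mul_const hψ
  filter_upwards [hlim.eventually_ge_atTop (z₀ * exp (θ * I)).re] with ρ hρ
  have hrot : z ρ * exp (θ * I) = ρ * exp (ψ * I) := by rw [hz, mul_exp_rotate]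
  have hmem : z ρ ∈ D := h.mem_of_re_le z₀ hz₀ _ <| by
    rwa [hrot, re_ofReal_mul, exp_ofReal_mul_I_re]
  simp only [expansionCoeff_mul_dirPow, h.eq_laplace _ hmem, hrot, ← Finset.mul_sum]
  ring

theorem hasAsymptoticExpansion (h : IsRayLaplaceTransform D Φ θ α J) (hD : D.Nonempty)
    (hτ : 0 < τ) {e : ℕ → ℂ}
    (hrem : ∀ n : ℕ, (fun t : ℝ => J t - ∑ k ∈ Finset.range n, e k * (t ^ (τ + k - 1) : ℝ))
      =O[𝓝[>] 0] fun t : ℝ => t ^ (τ + n - 1)) :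
    HasAsymptoticExpansion D Φ (-θ) α τ (expansionCoeff θ τ e) := by
  obtain ⟨z₀, hz₀⟩ := hD
  set x : ℝ := |(z₀ * exp (θ * I)).re| + 1
  have hx : 0 < x := by positivity
  have hre {z : ℂ} (hz : z ∈ sectorAtInfty (-θ) (Real.pi / 3) (2 * x)) :
      (z₀ * exp (θ * I)).re < (z * exp (θ * I)).re :=
    (le_abs_self _).trans_lt ((lt_add_one _).trans (lt_re_of_mem_sectorAtInfty hx hz))
  exact ⟨Real.pi / 3, 2 * x, by positivity, by linarith [Real.pi_pos], by positivity,
    fun z hz => h.mem_of_re_le z₀ hz₀ z (hre hz).le,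
    fun z hz => (h.differentiableAt hz₀ (hre hz)).differentiableWithinAt,
    fun ψ hψ n => h.isLittleO ⟨z₀, hz₀⟩ hτ (hrem (n + 1))
      (one_half_pos.trans (half_lt_cos hψ)) fun _ => rfl⟩

theorem laplace_eq (h : IsRayLaplaceTransform D Φ θ α J) {φ : ℂ → ℂ}
    (hφ : ∀ t : ℝ, 0 < t → φ (α + t * exp (θ * I)) = J t) (hz : z ∈ D) :
    IntegrableOn (laplaceIntegrand α θ φ z) (Ioi 0) ∧ laplace α θ φ z = Φ z := by
  have heq : EqOn (fun t : ℝ => exp (-(α * z)) * exp (θ * I) *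
      (exp (-(z * exp (θ * I) * t)) * J t)) (laplaceIntegrand α θ φ z) (Ioi 0) := by
    intro t ht
    have hexp : exp (-(z * (α + t * exp (θ * I)))) =
        exp (-(α * z)) * exp (-(z * exp (θ * I) * t)) := by
      rw [← exp_add]; ring_nf
    simp only [laplaceIntegrand]
    rw [hφ t ht, hexp]
    ring
  refine ⟨IntegrableOn.congr_fun (Integrable.const_mul (h.integrableAt z hz) _) heq
    measurableSet_Ioi, ?_⟩
  rw [laplace, h.eq_laplace z hz, halfLineLaplace, ← integral_const_mul]
  exact (setIntegral_congr_fun measurableSet_Ioi heq).symm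

theorem isBorelRegular (h : IsRayLaplaceTransform D Φ θ α J) (hD : D.Nonempty) (hτ : 0 < τ)
    (hJ : AnalyticOnNhd ℝ J (Ioi 0)) {G : ℂ → ℂ} (hG : AnalyticAt ℂ G 0)
    (hJG : ∀ᶠ t : ℝ in 𝓝[>] 0, J t = (t ^ (τ - 1) : ℝ) * G t) :
    IsBorelRegular D Φ θ α τ := by
  obtain ⟨p, hp⟩ := hG
  have hexp : HasAsymptoticExpansion D Φ (-θ) α τ (expansionCoeff θ τ p.coeff) :=
    h.hasAsymptoticExpansion hD hτ (sub_sum_isBigO_of_hasFPowerSeriesAt hp hJG)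
  refine ⟨⟨_, hexp⟩, fun c hc => ?_, fun c hc => ?_⟩
  · rw [hc.unique hexp]
    exact convergesNearTip_expansionCoeff θ hτ hp
  · rw [hc.unique hexp]
    refine ⟨_, _, isContinuationAlongRay_holomorphicExtension α θ hτ hJ hp hJG, fun z hz =>
      h.laplace_eq (fun t ht => ?_) hz⟩
    rw [rotate_ray_point, holomorphicExtension_ofReal (hJ t ht)]

end IsRayLaplaceTransform

theorem hasSum_even_coeff {E : ℂ → ℂ} {p : FormalMultilinearSeries ℂ ℂ ℂ} {v : ℂ}
    (hpos : HasSum (fun n => v ^ n • p.coeff n) (E v))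
    (hneg : HasSum (fun n => (-v) ^ n • p.coeff n) (E v)) :
    HasSum (fun n => (v ^ 2) ^ n • p.coeff (2 * n)) (E v) := by
  have hmean := (hpos.add hneg).div_const 2
  rw [add_self_div_two] at hmean
  refine (((mul_right_injective₀ (two_ne_zero' ℕ)).hasSum_iff fun n hn => ?_).2 hmean).congr_fun ?_
  · have hodd : Odd n := Nat.not_even_iff_odd.1 fun h => hn (even_iff_exists_two_mul.1 h |>.imp
      fun _ => Eq.symm)
    rw [hodd.neg_pow, neg_smul, add_neg_cancel, zero_div]
  · intro n
    simp only [Function.comp_apply, (even_two_mul n).neg_pow, add_self_div_two, pow_mul]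

theorem sq_cpow_half (u : ℂ) : (u ^ (1 / 2 : ℂ)) ^ 2 = u := by
  rw [← cpow_nat_mul]; norm_num

theorem exists_comp_sq_eventuallyEq_of_even {E : ℂ → ℂ} (hE : AnalyticAt ℂ E 0)
    (heven : ∀ᶠ v in 𝓝 0, E (-v) = E v) :
    ∃ G : ℂ → ℂ, AnalyticAt ℂ G 0 ∧ ∀ᶠ v in 𝓝 0, E v = G (v ^ 2) := by
  obtain ⟨p, hp⟩ := hE
  have hseries : ∀ᶠ v in 𝓝 0, HasSum (fun n => v ^ n • p.coeff n) (E v) := by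
    simpa using hasFPowerSeriesAt_iff.1 hp
  have hneg : Tendsto (fun v : ℂ => -v) (𝓝 0) (𝓝 0) := continuous_neg.tendsto' 0 0 neg_zero
  have hroot : Tendsto (fun u : ℂ => u ^ (1 / 2 : ℂ)) (𝓝 0) (𝓝 0) := by
    simpa using
      (continuousAt_cpow_const_of_re_pos (z := 0) (w := 1 / 2) (by simp) (by simp)).tendsto
  refine ⟨fun u => E (u ^ (1 / 2 : ℂ)),
    ⟨.ofScalars ℂ fun n => p.coeff (2 * n), hasFPowerSeriesAt_iff.2 ?_⟩, ?_⟩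
  · filter_upwards [hroot.eventually hseries, hroot.eventually (hneg.eventually hseries),
      hroot.eventually heven] with u hpos hneg heven
    simpa [sq_cpow_half] using hasSum_even_coeff hpos (heven ▸ hneg)
  · filter_upwards [heven] with v hv
    rcases sq_eq_sq_iff_eq_or_eq_neg.1 (sq_cpow_half (v ^ 2)) with h | h
    · rw [h]
    · rw [h, hv]

theorem exists_analyticAt_sq_eq {q : ℂ → ℂ} {w₀ : ℂ} (hq : AnalyticAt ℂ q w₀) (h0 : q w₀ ≠ 0) :
    ∃ S : ℂ → ℂ, AnalyticAt ℂ S w₀ ∧ ∀ w, S w ^ 2 = q w := by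
  refine ⟨fun w => q w₀ ^ (1 / 2 : ℂ) * (q w / q w₀) ^ (1 / 2 : ℂ), ?_, fun w => ?_⟩
  · exact analyticAt_const.mul
      ((hq.div analyticAt_const h0).cpow analyticAt_const (by simp [h0]))
  · rw [mul_pow, sq_cpow_half, sq_cpow_half, mul_div_cancel₀ _ h0]

theorem exists_sub_eq_sq_mul {F : ℂ → ℂ} {w₀ : ℂ} (hF : AnalyticAt ℂ F w₀)
    (h1 : deriv F w₀ = 0) (h2 : iteratedDeriv 2 F w₀ ≠ 0) :
    ∃ q : ℂ → ℂ, AnalyticAt ℂ q w₀ ∧ q w₀ ≠ 0 ∧ ∀ᶠ w in 𝓝 w₀, F w - F w₀ = (w - w₀) ^ 2 * q w := by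
  have hsub : AnalyticAt ℂ (fun w => F w - F w₀) w₀ := hF.sub analyticAt_const
  have horder : analyticOrderAt (fun w => F w - F w₀) w₀ = (2 : ℕ) := by
    have hderiv : deriv (fun w => F w - F w₀) = deriv F := funext fun w => deriv_sub_const _
    rw [analyticOrderAt_eq_nat_iff_iteratedDeriv_eq_zero hsub, iteratedDeriv_succ', hderiv,
      ← iteratedDeriv_succ']
    refine ⟨fun k hk => ?_, h2⟩
    interval_cases k
    · simp
    · rw [iteratedDeriv_one, hderiv, h1]
  simpa only [smul_eq_mul] using hsub.analyticOrderAt_eq_natCast.1 horder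

theorem exists_morse_coordinate {F : ℂ → ℂ} {w₀ : ℂ} (hF : AnalyticAt ℂ F w₀)
    (h1 : deriv F w₀ = 0) (h2 : iteratedDeriv 2 F w₀ ≠ 0) :
    ∃ W : ℂ → ℂ, AnalyticAt ℂ W w₀ ∧ W w₀ = 0 ∧ deriv W w₀ ≠ 0 ∧
      ∀ᶠ w in 𝓝 w₀, F w - F w₀ = W w ^ 2 := by
  obtain ⟨q, hq, hq0, hFq⟩ := exists_sub_eq_sq_mul hF h1 h2
  obtain ⟨S, hS, hSq⟩ := exists_analyticAt_sq_eq hq hq0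
  have hderiv : HasDerivAt (fun w => (w - w₀) * S w) (S w₀) w₀ := by
    simpa using ((hasDerivAt_id' w₀).sub_const w₀).fun_mul hS.differentiableAt.hasDerivAt
  refine ⟨fun w => (w - w₀) * S w, by fun_prop, by simp, ?_, ?_⟩
  · rw [hderiv.deriv]
    exact (pow_ne_zero_iff two_ne_zero).1 (hSq w₀ ▸ hq0)
  · simpa only [mul_pow, hSq] using hFq

theorem exists_eventuallyEq_comp {f g : ℂ → ℂ} {w₀ : ℂ} (hf : AnalyticAt ℂ f w₀)
    (hf' : deriv f w₀ ≠ 0) (hg : AnalyticAt ℂ g w₀) :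
    ∃ ψ : ℂ → ℂ, AnalyticAt ℂ ψ (f w₀) ∧ ∀ᶠ w in 𝓝 w₀, g w = ψ (f w) := by
  let R := hf.hasStrictDerivAt.localInverse f (deriv f w₀) w₀ hf'
  have hleft : ∀ᶠ w in 𝓝 w₀, R (f w) = w :=
    HasStrictDerivAt.eventually_left_inverse hf.hasStrictDerivAt hf'
  refine ⟨g ∘ R, AnalyticAt.comp (by rwa [hleft.self_of_nhds])
    (hf.analyticAt_localInverse hf'), hleft.mono fun w hw => ?_⟩
  rw [Function.comp_apply, hw]

/-- `h` restricts to a diffeomorphism of the half-line `(0, ∞)` onto itself which extends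
continuously by `h 0 = 0`. -/
structure IsHalfLineChange (h : ℝ → ℝ) : Prop where
  contDiff : ContDiff ℝ 1 h
  map_zero : h 0 = 0
  deriv_ne_zero : ∀ s, 0 < s → deriv h s ≠ 0
  tendsto_atTop : Tendsto h atTop atTop

/-- The function `q`, given in the parameter `s > 0`, as a function of the new parameter
`t = h s`. -/
def transport (h : ℝ → ℝ) (q : ℝ → ℂ) (t : ℝ) : ℂ := q (Function.invFunOn h (Ioi 0) t)

namespace IsHalfLineChange

variable {h : ℝ → ℝ} {q : ℝ → ℂ} {s : ℝ}

theorem hasStrictDerivAt (hh : IsHalfLineChange h) (s : ℝ) : HasStrictDerivAt h (deriv h s) s :=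
  hh.contDiff.contDiffAt.hasStrictDerivAt one_ne_zero

theorem deriv_pos (hh : IsHalfLineChange h) (hs : 0 < s) : 0 < deriv h s := by
  rcases hasDerivWithinAt_forall_lt_or_forall_gt_of_forall_ne (convex_Ioi (0 : ℝ))
    (fun s _ => (hh.hasStrictDerivAt s).hasDerivAt.hasDerivWithinAt) (m := 0)
    hh.deriv_ne_zero with hneg | hpos
  · have hanti : StrictAntiOn h (Ici 0) :=
      strictAntiOn_of_deriv_neg (convex_Ici 0) hh.contDiff.continuous.continuousOn
        (by rwa [interior_Ici])
    obtain ⟨b, hb, hb0⟩ :=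
      ((hh.tendsto_atTop.eventually_gt_atTop 0).and (eventually_ge_atTop 0)).exists
    have hle : h b ≤ h 0 := hanti.antitoneOn self_mem_Ici hb0 hb0
    exact absurd (hb.trans_le hle) (by simp [hh.map_zero])
  · exact hpos s hs

theorem strictMonoOn (hh : IsHalfLineChange h) : StrictMonoOn h (Ici 0) :=
  strictMonoOn_of_deriv_pos (convex_Ici 0) hh.contDiff.continuous.continuousOn fun s hs =>
    hh.deriv_pos (by rwa [interior_Ici] at hs)

theorem injOn (hh : IsHalfLineChange h) : InjOn h (Ioi 0) :=
  hh.strictMonoOn.injOn.mono Ioi_subset_Ici_self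

theorem pos (hh : IsHalfLineChange h) (hs : 0 < s) : 0 < h s :=
  hh.map_zero ▸ hh.strictMonoOn self_mem_Ici hs.le hs

theorem image_Ioi (hh : IsHalfLineChange h) : h '' Ioi 0 = Ioi 0 := by
  refine Subset.antisymm (image_subset_iff.2 fun s => hh.pos) fun t (ht : 0 < t) => ?_
  obtain ⟨b, hb, hb0⟩ :=
    ((hh.tendsto_atTop.eventually_ge_atTop t).and (eventually_ge_atTop 0)).exists
  obtain ⟨s, hs, rfl⟩ := intermediate_value_Icc hb0 hh.contDiff.continuous.continuousOn
    ⟨hh.map_zero.trans_le ht.le, hb⟩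
  exact ⟨s, hs.1.lt_of_ne fun h0 => ht.ne (by rw [← h0, hh.map_zero]), rfl⟩

theorem exists_eq (hh : IsHalfLineChange h) {t : ℝ} (ht : 0 < t) : ∃ s, 0 < s ∧ h s = t :=
  hh.image_Ioi.ge ht

theorem transport_apply (hh : IsHalfLineChange h) (hs : 0 < s) : transport h q (h s) = q s :=
  congrArg q (hh.injOn.leftInvOn_invFunOn hs)

theorem eventually_nhdsGT (hh : IsHalfLineChange h) {p : ℝ → Prop}
    (hp : ∀ᶠ s in 𝓝[>] 0, p (h s)) : ∀ᶠ t in 𝓝[>] 0, p t := by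
  obtain ⟨r, hr : 0 < r, hp⟩ := mem_nhdsGT_iff_exists_Ioo_subset.1 hp
  filter_upwards [Ioo_mem_nhdsGT (hh.pos hr)] with t ht
  obtain ⟨s, hs, rfl⟩ := hh.exists_eq ht.1
  exact hp ⟨hs, (hh.strictMonoOn.lt_iff_lt hs.le hr.le).1 ht.2⟩

theorem analyticAt_transport (hh : IsHalfLineChange h) (hs : 0 < s) {ψ : ℝ → ℂ}
    (hψ : AnalyticAt ℝ ψ (h s)) (hq : ∀ᶠ s' in 𝓝 s, q s' = ψ (h s')) :
    AnalyticAt ℝ (transport h q) (h s) := by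
  refine hψ.congr (EventuallyEq.symm ?_)
  rw [EventuallyEq, ← (hh.hasStrictDerivAt s).map_nhds_eq (hh.deriv_ne_zero s hs),
    eventually_map]
  filter_upwards [hq, Ioi_mem_nhds hs] with s' hs' hpos
  rw [hh.transport_apply hpos, hs']

theorem integrableOn_iff (hh : IsHalfLineChange h) (T : ℝ → ℂ) :
    IntegrableOn T (Ioi 0) ↔ IntegrableOn (fun s => deriv h s • T (h s)) (Ioi 0) := by
  rw [← integrableOn_image_iff_integrableOn_deriv_smul_of_monotoneOn measurableSet_Ioi
    (fun s _ => (hh.hasStrictDerivAt s).hasDerivAt.hasDerivWithinAt)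
    (hh.strictMonoOn.monotoneOn.mono Ioi_subset_Ici_self), hh.image_Ioi]

theorem integral_eq (hh : IsHalfLineChange h) (T : ℝ → ℂ) :
    ∫ t in Ioi 0, T t = ∫ s in Ioi 0, deriv h s • T (h s) := by
  rw [← integral_image_eq_integral_deriv_smul_of_monotoneOn measurableSet_Ioi
    (fun s _ => (hh.hasStrictDerivAt s).hasDerivAt.hasDerivWithinAt)
    (hh.strictMonoOn.monotoneOn.mono Ioi_subset_Ici_self), hh.image_Ioi]

theorem eqOn_smul_transport (hh : IsHalfLineChange h) (q : ℝ → ℂ) (y : ℂ) :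
    EqOn (fun s => deriv h s • (exp (-(y * h s)) * transport h q (h s)))
      (fun s => exp (-(y * h s)) * q s * deriv h s) (Ioi 0) := fun s hs => by
  simp only [hh.transport_apply hs, real_smul, mul_comm]

theorem laplaceIntegrableAt_transport_iff (hh : IsHalfLineChange h) {y : ℂ} :
    LaplaceIntegrableAt (transport h q) y ↔
      IntegrableOn (fun s => exp (-(y * h s)) * q s * deriv h s) (Ioi 0) := by
  rw [LaplaceIntegrableAt, hh.integrableOn_iff,
    integrableOn_congr_fun (hh.eqOn_smul_transport q y) measurableSet_Ioi]

theorem halfLineLaplace_transport (hh : IsHalfLineChange h) (q : ℝ → ℂ) (y : ℂ) :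
    halfLineLaplace (transport h q) y =
      ∫ s in Ioi 0, exp (-(y * h s)) * q s * deriv h s := by
  rw [halfLineLaplace, hh.integral_eq,
    setIntegral_congr_fun measurableSet_Ioi (hh.eqOn_smul_transport q y)]

end IsHalfLineChange

theorem eventually_eq_sign_mul_abs {x : ℝ → ℝ} {d : ℝ} (hx : HasDerivAt x d 0) (hd : 0 < d)
    (h0 : x 0 = 0) : ∀ᶠ s in 𝓝 0, x s = SignType.sign s * |x s| := by
  filter_upwards [eventually_nhdsWithin_sign_eq_of_deriv_pos (by rwa [hx.deriv]) h0] with s hs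
  rw [sub_zero] at hs
  rw [← hs, sign_mul_abs]

theorem exists_eventually_eq_mul_sign_mul_sqrt {y : ℝ → ℂ} {c : ℂ} {h : ℝ → ℝ}
    (hy : HasDerivAt y c 0) (hc : c ≠ 0) (hy0 : y 0 = 0) (hh : ∀ s, 0 ≤ h s)
    (hsq : ∀ᶠ s in 𝓝 0, y s ^ 2 = h s) :
    ∃ σ : ℂ, σ ≠ 0 ∧ ∀ᶠ s in 𝓝 0, y s = σ * (SignType.sign s * √(h s) : ℝ) := by
  have hreal : ∀ᶠ s in 𝓝 0, y s = (y s).re ∧ |(y s).re| = √(h s) := by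
    filter_upwards [hsq] with s hs
    rw [← Real.sq_sqrt (hh s), ofReal_pow, sq_eq_sq_iff_eq_or_eq_neg, ← ofReal_neg] at hs
    rcases hs with hs | hs <;> simp [hs]
  have him : c.im = 0 :=
    (imCLM.hasFDerivAt.comp_hasDerivAt (0 : ℝ) hy).unique <|
      (hasDerivAt_const (0 : ℝ) (0 : ℝ)).congr_of_eventuallyEq <| by
        filter_upwards [hreal] with s hs
        simpa using congrArg im hs.1
  have hre : c.re ≠ 0 := fun hre => hc (Complex.ext hre him)
  have hx : HasDerivAt (fun s => c.re * (y s).re) (c.re * c.re) 0 :=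
    (reCLM.hasFDerivAt.comp_hasDerivAt (0 : ℝ) hy).const_mul c.re
  refine ⟨(|c.re| / c.re : ℝ), by simpa using hre, ?_⟩
  filter_upwards [hreal, eventually_eq_sign_mul_abs hx (mul_self_pos.2 hre) (by simp [hy0])]
    with s hs hsign
  rw [abs_mul, hs.2] at hsign
  rw [hs.1, ← ofReal_mul, ofReal_inj]
  field_simp
  linear_combination hsign

theorem deriv_eq_two_mul_mul_deriv {F W : ℂ → ℂ} {w₀ c : ℂ} (hW : AnalyticAt ℂ W w₀)
    (hFW : ∀ᶠ w in 𝓝 w₀, F w - c = W w ^ 2) :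
    ∀ᶠ w in 𝓝 w₀, deriv F w = 2 * W w * deriv W w := by
  filter_upwards [hFW.eventually_nhds, hW.eventually_analyticAt] with w hFW hW
  rw [← deriv_sub_const c, EventuallyEq.deriv_eq hFW, deriv_fun_pow hW.differentiableAt]
  simp

theorem exists_div_deriv_eq_comp_div {F W g : ℂ → ℂ} {w₀ c : ℂ} (hW : AnalyticAt ℂ W w₀)
    (hW' : deriv W w₀ ≠ 0) (hFW : ∀ᶠ w in 𝓝 w₀, F w - c = W w ^ 2) (hg : AnalyticAt ℂ g w₀) :
    ∃ k, AnalyticAt ℂ k (W w₀) ∧ ∀ᶠ w in 𝓝 w₀, g w / deriv F w = k (W w) / W w := by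
  obtain ⟨k, hk, hkg⟩ := exists_eventuallyEq_comp hW hW'
    (hg.fun_div (analyticAt_const.fun_mul hW.deriv) (mul_ne_zero two_ne_zero hW'))
  refine ⟨k, hk, ?_⟩
  filter_upwards [hkg, deriv_eq_two_mul_mul_deriv hW hFW] with w hkg hF'
  rw [← hkg, hF', div_div]
  ring

section Manifold

variable {X : Type*} [TopologicalSpace X] [ChartedSpace ℂ X] {f : X → ℂ}
  {ν : (x : X) → TangentSpace 𝓘(ℂ) x →L[ℂ] ℂ} {γ : ℝ → X}

/-- The differential of `f` at `x`, read as a linear form on `ℂ`. -/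
def differential (f : X → ℂ) (x : X) : ℂ →L[ℂ] ℂ := mfderiv 𝓘(ℂ) 𝓘(ℂ) f x

/-- The value of the form `ν` at `x`, read as a linear form on `ℂ`. -/
def formAt (ν : (x : X) → TangentSpace 𝓘(ℂ) x →L[ℂ] ℂ) (x : X) : ℂ →L[ℂ] ℂ := ν x

/-- The velocity of a curve, read as a complex number. -/
def complexVelocity (γ : ℝ → X) (s : ℝ) : ℂ := velocity γ s

/-- The differential of the inverse of the chart at `x₀`, read as a linear form on `ℂ`. -/
def chartSymmDifferential (x₀ : X) (w : ℂ) : ℂ →L[ℂ] ℂ :=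
  mfderiv 𝓘(ℂ) 𝓘(ℂ) (extChartAt 𝓘(ℂ) x₀).symm w

/-- The quotient `ν / df` of a one-form by the differential of `f`: the function `q` with
`ν = q df` off the critical points of `f`, and `0` at the critical points. -/
def formRatio (f : X → ℂ) (ν : (x : X) → TangentSpace 𝓘(ℂ) x →L[ℂ] ℂ) (x : X) : ℂ :=
  formAt ν x 1 / differential f x 1

theorem linearForm_apply (L : ℂ →L[ℂ] ℂ) (v : ℂ) : L v = v * L 1 := by
  simpa using L.map_smul v 1

theorem differential_apply_ne_zero {x : X} (hx : ¬ IsCriticalPoint f x) {v : ℂ} (hv : v ≠ 0) :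
    differential f x v ≠ 0 := fun h => hx <| by
  have h1 : differential f x 1 = 0 := by
    rw [linearForm_apply] at h
    exact (mul_eq_zero.1 h).resolve_left hv
  exact (ContinuousLinearMap.ext_ring h1 : differential f x = 0)

theorem formRatio_eq_div (x : X) {v : ℂ} (hv : v ≠ 0) :
    formRatio f ν x = formAt ν x v / differential f x v := by
  rw [linearForm_apply (formAt ν x) v, linearForm_apply (differential f x) v, formRatio,
    mul_div_mul_left _ _ hv]

theorem formAt_eq_formRatio_mul {x : X} (hx : ¬ IsCriticalPoint f x) {v : ℂ} (hv : v ≠ 0) :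
    formAt ν x v = formRatio f ν x * differential f x v := by
  rw [formRatio_eq_div x hv, div_mul_cancel₀ _ (differential_apply_ne_zero hx hv)]

theorem deriv_comp_extChartAt_symm_self (hf : MDifferentiable 𝓘(ℂ) 𝓘(ℂ) f) (x₀ : X) :
    deriv (f ∘ (extChartAt 𝓘(ℂ) x₀).symm) (extChartAt 𝓘(ℂ) x₀ x₀) = differential f x₀ 1 := by
  rw [differential, (hf x₀).mfderiv, ModelWithCorners.range_eq_univ, fderivWithin_univ]
  rfl

theorem eventually_of_extChartAt {x₀ : X} {p : X → ℂ → Prop}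
    (h : ∀ᶠ w in 𝓝 (extChartAt 𝓘(ℂ) x₀ x₀), p ((extChartAt 𝓘(ℂ) x₀).symm w) w) :
    ∀ᶠ x in 𝓝 x₀, p x (extChartAt 𝓘(ℂ) x₀ x) := by
  filter_upwards [(continuousAt_extChartAt (I := 𝓘(ℂ)) x₀).eventually h,
    extChartAt_source_mem_nhds (I := 𝓘(ℂ)) x₀] with x hx hxs
  rwa [(extChartAt 𝓘(ℂ) x₀).left_inv hxs] at hx

theorem contDiffAt_extChartAt_comp (hγ : ContMDiff 𝓘(ℝ, ℝ) 𝓘(ℝ, ℂ) 1 γ) (s : ℝ) :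
    ContDiffAt ℝ 1 (extChartAt 𝓘(ℂ) (γ s) ∘ γ) s := by
  have h := (contMDiffAt_iff.1 (hγ s)).2
  rw [ModelWithCorners.range_eq_univ, contDiffWithinAt_univ] at h
  exact h

theorem hasDerivAt_extChartAt_comp (hγ : ContMDiff 𝓘(ℝ, ℝ) 𝓘(ℝ, ℂ) 1 γ) (s : ℝ) :
    HasDerivAt (extChartAt 𝓘(ℂ) (γ s) ∘ γ) (complexVelocity γ s) s := by
  have hmd : MDifferentiableAt 𝓘(ℝ, ℝ) 𝓘(ℝ, ℂ) γ s := (hγ s).mdifferentiableAt one_ne_zero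
  have hv : complexVelocity γ s = deriv (extChartAt 𝓘(ℂ) (γ s) ∘ γ) s := by
    rw [complexVelocity, velocity, hmd.mfderiv, ModelWithCorners.range_eq_univ, fderivWithin_univ]
    rfl
  rw [hv]
  exact ((contDiffAt_extChartAt_comp hγ s).differentiableAt one_ne_zero).hasDerivAt

theorem eventuallyEq_comp_curve (hγ : ContMDiff 𝓘(ℝ, ℝ) 𝓘(ℝ, ℂ) 1 γ) (s : ℝ) :
    f ∘ γ =ᶠ[𝓝 s]
      (f ∘ (extChartAt 𝓘(ℂ) (γ s)).symm) ∘ (extChartAt 𝓘(ℂ) (γ s) ∘ γ) := by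
  filter_upwards [hγ.continuous.continuousAt.eventually
    (extChartAt_source_mem_nhds (I := 𝓘(ℂ)) (γ s))] with s' hs'
  simp only [Function.comp_apply, (extChartAt 𝓘(ℂ) (γ s)).left_inv hs']

theorem complexVelocity_comp_neg (hγ : ContMDiff 𝓘(ℝ, ℝ) 𝓘(ℝ, ℂ) 1 γ) (s : ℝ) :
    complexVelocity (fun s => γ (-s)) s = -complexVelocity γ (-s) := by
  have h := (hasDerivAt_extChartAt_comp hγ (-s)).scomp s (hasDerivAt_neg s)
  rw [neg_one_smul] at h
  exact (hasDerivAt_extChartAt_comp (hγ.comp contDiff_neg.contMDiff) s).unique h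

theorem thimbleIntegrand_comp_neg (hγ : ContMDiff 𝓘(ℝ, ℝ) 𝓘(ℝ, ℂ) 1 γ) (z : ℂ) (s : ℝ) :
    thimbleIntegrand f ν (fun s => γ (-s)) z s = -thimbleIntegrand f ν γ z (-s) := by
  change _ * formAt ν (γ (-s)) (complexVelocity (fun s => γ (-s)) s) =
    -(_ * formAt ν (γ (-s)) (complexVelocity γ (-s)))
  rw [complexVelocity_comp_neg hγ, map_neg, mul_neg]

variable [IsManifold 𝓘(ℂ) 1 X]

theorem mdifferentiableAt_extChartAt_symm_of_mem_target {x₀ : X} {w : ℂ}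
    (hw : w ∈ (extChartAt 𝓘(ℂ) x₀).target) :
    MDifferentiableAt 𝓘(ℂ) 𝓘(ℂ) (extChartAt 𝓘(ℂ) x₀).symm w := by
  have h := mdifferentiableWithinAt_extChartAt_symm (I := 𝓘(ℂ)) hw
  rwa [ModelWithCorners.range_eq_univ, mdifferentiableWithinAt_univ] at h

theorem chartSymmDifferential_one_ne_zero {x₀ : X} {w : ℂ}
    (hw : w ∈ (extChartAt 𝓘(ℂ) x₀).target) : chartSymmDifferential x₀ w 1 ≠ 0 := by
  have h := isInvertible_mfderivWithin_extChartAt_symm (I := 𝓘(ℂ)) hw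
  rw [ModelWithCorners.range_eq_univ, mfderivWithin_univ] at h
  have hinj : Function.Injective (chartSymmDifferential x₀ w) := h.injective
  exact fun h0 => one_ne_zero (hinj (h0.trans (map_zero _).symm))

theorem hasDerivAt_comp_extChartAt_symm (hf : MDifferentiable 𝓘(ℂ) 𝓘(ℂ) f) {x₀ : X} {w : ℂ}
    (hw : w ∈ (extChartAt 𝓘(ℂ) x₀).target) :
    HasDerivAt (f ∘ (extChartAt 𝓘(ℂ) x₀).symm)
      (differential f ((extChartAt 𝓘(ℂ) x₀).symm w) (chartSymmDifferential x₀ w 1)) w := by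
  have hF : HasFDerivAt (f ∘ (extChartAt 𝓘(ℂ) x₀).symm)
      ((differential f ((extChartAt 𝓘(ℂ) x₀).symm w)).comp (chartSymmDifferential x₀ w)) w :=
    ((hf _).hasMFDerivAt.comp w
      (mdifferentiableAt_extChartAt_symm_of_mem_target hw).hasMFDerivAt).hasFDerivAt
  exact hF.hasDerivAt

theorem analyticAt_comp_extChartAt_symm (hf : MDifferentiable 𝓘(ℂ) 𝓘(ℂ) f) (x₀ : X) :
    AnalyticAt ℂ (f ∘ (extChartAt 𝓘(ℂ) x₀).symm) (extChartAt 𝓘(ℂ) x₀ x₀) :=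
  DifferentiableOn.analyticAt
    (fun _ hw => (hasDerivAt_comp_extChartAt_symm hf hw).differentiableAt.differentiableWithinAt)
    (extChartAt_target_mem_nhds x₀)

theorem exists_formRatio_extChartAt_symm (hf : MDifferentiable 𝓘(ℂ) 𝓘(ℂ) f)
    (hν : IsHolomorphicOneForm ν) (x₀ : X) :
    ∃ g : ℂ → ℂ, AnalyticAt ℂ g (extChartAt 𝓘(ℂ) x₀ x₀) ∧
      ∀ᶠ w in 𝓝 (extChartAt 𝓘(ℂ) x₀ x₀), formRatio f ν ((extChartAt 𝓘(ℂ) x₀).symm w) =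
        g w / deriv (f ∘ (extChartAt 𝓘(ℂ) x₀).symm) w := by
  have htarget := extChartAt_target_mem_nhds (I := 𝓘(ℂ)) x₀
  refine ⟨_, (hν x₀).analyticAt htarget, ?_⟩
  filter_upwards [htarget] with w hw
  rw [(hasDerivAt_comp_extChartAt_symm hf hw).deriv]
  exact formRatio_eq_div _ (chartSymmDifferential_one_ne_zero hw)

theorem exists_formRatio_eq_comp (hf : MDifferentiable 𝓘(ℂ) 𝓘(ℂ) f)
    (hν : IsHolomorphicOneForm ν) {x₀ : X} (hx₀ : ¬ IsCriticalPoint f x₀) :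
    ∃ ψ : ℂ → ℂ, AnalyticAt ℂ ψ (f x₀) ∧ ∀ᶠ x in 𝓝 x₀, formRatio f ν x = ψ (f x) := by
  obtain ⟨g, hg, hratio⟩ := exists_formRatio_extChartAt_symm hf hν x₀
  have hF := analyticAt_comp_extChartAt_symm hf x₀
  have hF' : deriv (f ∘ (extChartAt 𝓘(ℂ) x₀).symm) (extChartAt 𝓘(ℂ) x₀ x₀) ≠ 0 := by
    rw [deriv_comp_extChartAt_symm_self hf]
    exact differential_apply_ne_zero hx₀ one_ne_zero
  obtain ⟨ψ, hψ, hψg⟩ := exists_eventuallyEq_comp hF hF' (hg.fun_div hF.deriv hF')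
  refine ⟨ψ, by simpa only [Function.comp_apply, extChartAt_to_inv] using hψ,
    eventually_of_extChartAt (p := fun x _ => formRatio f ν x = ψ (f x)) ?_⟩
  filter_upwards [hψg, hratio] with w hψg hratio
  rw [hratio, hψg, Function.comp_apply]

theorem exists_morse_coordinate_formRatio (hf : MDifferentiable 𝓘(ℂ) 𝓘(ℂ) f)
    (hν : IsHolomorphicOneForm ν) {a : X} (ha : IsNondegenerateCriticalPoint f a) :
    ∃ W k : ℂ → ℂ, AnalyticAt ℂ W (extChartAt 𝓘(ℂ) a a) ∧ W (extChartAt 𝓘(ℂ) a a) = 0 ∧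
      deriv W (extChartAt 𝓘(ℂ) a a) ≠ 0 ∧ AnalyticAt ℂ k 0 ∧
      ∀ᶠ x in 𝓝 a, f x - f a = W (extChartAt 𝓘(ℂ) a x) ^ 2 ∧
        formRatio f ν x = k (W (extChartAt 𝓘(ℂ) a x)) / W (extChartAt 𝓘(ℂ) a x) := by
  obtain ⟨g, hg, hratio⟩ := exists_formRatio_extChartAt_symm hf hν a
  have hF' : deriv (f ∘ (extChartAt 𝓘(ℂ) a).symm) (extChartAt 𝓘(ℂ) a a) = 0 := by
    rw [deriv_comp_extChartAt_symm_self hf, show differential f a = 0 from ha.1,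
      zero_apply]
  obtain ⟨W, hW, hW0, hW', hFW⟩ :=
    exists_morse_coordinate (analyticAt_comp_extChartAt_symm hf a) hF' ha.2
  obtain ⟨k, hk, hkW⟩ := exists_div_deriv_eq_comp_div hW hW' hFW hg
  refine ⟨W, k, hW, hW0, hW', hW0 ▸ hk, eventually_of_extChartAt
    (p := fun x w => f x - f a = W w ^ 2 ∧ formRatio f ν x = k (W w) / W w) ?_⟩
  filter_upwards [hFW, hkW, hratio] with w hFW hkW hratio
  exact ⟨by simpa only [Function.comp_apply, extChartAt_to_inv] using hFW, hratio.trans hkW⟩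

theorem exists_morse_coordinate_along_curve (hf : MDifferentiable 𝓘(ℂ) 𝓘(ℂ) f)
    (hν : IsHolomorphicOneForm ν) (hγ : ContMDiff 𝓘(ℝ, ℝ) 𝓘(ℝ, ℂ) 1 γ) {s₀ : ℝ}
    (hv : complexVelocity γ s₀ ≠ 0) (ha : IsNondegenerateCriticalPoint f (γ s₀)) :
    ∃ (y : ℝ → ℂ) (c : ℂ) (k : ℂ → ℂ), HasDerivAt y c s₀ ∧ c ≠ 0 ∧ y s₀ = 0 ∧
      AnalyticAt ℂ k 0 ∧ ∀ᶠ s in 𝓝 s₀, f (γ s) - f (γ s₀) = y s ^ 2 ∧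
        formRatio f ν (γ s) = k (y s) / y s := by
  obtain ⟨W, k, hW, hW0, hW', hk, hWk⟩ := exists_morse_coordinate_formRatio hf hν ha
  exact ⟨_, _, k, hW.differentiableAt.hasDerivAt.scomp s₀ (hasDerivAt_extChartAt_comp hγ s₀),
    smul_ne_zero hv hW', hW0, hk, hγ.continuous.continuousAt.eventually hWk⟩

theorem contDiff_comp_curve (hf : MDifferentiable 𝓘(ℂ) 𝓘(ℂ) f)
    (hγ : ContMDiff 𝓘(ℝ, ℝ) 𝓘(ℝ, ℂ) 1 γ) : ContDiff ℝ 1 (f ∘ γ) :=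
  contDiff_iff_contDiffAt.2 fun s =>
    (((analyticAt_comp_extChartAt_symm hf (γ s)).contDiffAt.restrict_scalars ℝ).comp s
      (contDiffAt_extChartAt_comp hγ s)).congr_of_eventuallyEq (eventuallyEq_comp_curve hγ s)

theorem hasDerivAt_comp_curve (hf : MDifferentiable 𝓘(ℂ) 𝓘(ℂ) f)
    (hγ : ContMDiff 𝓘(ℝ, ℝ) 𝓘(ℝ, ℂ) 1 γ) (s : ℝ) :
    HasDerivAt (f ∘ γ) (differential f (γ s) (complexVelocity γ s)) s := by
  have h := (analyticAt_comp_extChartAt_symm hf (γ s)).differentiableAt.hasDerivAt.scomp s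
    (hasDerivAt_extChartAt_comp hγ s)
  rw [deriv_comp_extChartAt_symm_self hf, smul_eq_mul, ← linearForm_apply] at h
  exact h.congr_of_eventuallyEq (eventuallyEq_comp_curve hγ s)

theorem thimbleIntegrand_eq (hf : MDifferentiable 𝓘(ℂ) 𝓘(ℂ) f)
    (hγ : ContMDiff 𝓘(ℝ, ℝ) 𝓘(ℝ, ℂ) 1 γ) {s : ℝ} (hs : ¬ IsCriticalPoint f (γ s))
    (hv : complexVelocity γ s ≠ 0) (z : ℂ) :
    thimbleIntegrand f ν γ z s =
      exp (-(z * f (γ s))) * formRatio f ν (γ s) * deriv (f ∘ γ) s := by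
  rw [(hasDerivAt_comp_curve hf hγ s).deriv, mul_assoc, ← formAt_eq_formRatio_mul hs hv]
  rfl

end Manifold

section OrientedThimble

variable {X : Type*} {f : X → ℂ} {a : X} {θ : ℝ}

/-- The coordinate of `f x` on the line through `f a` of direction `θ`: where `f x` lies on the
ray it is the number `t ≥ 0` with `f x = f a + t e^{iθ}`. -/
def height (f : X → ℂ) (a : X) (θ : ℝ) (x : X) : ℝ := (exp (-(θ * I)) * (f x - f a)).re

theorem height_eq_of_eq {x : X} {t : ℝ} (h : f x = f a + t * exp (θ * I)) :
    height f a θ x = t := by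
  rw [height, h, add_sub_cancel_left, mul_left_comm, ← exp_add, neg_add_cancel, exp_zero,
    mul_one, ofReal_re]

variable [TopologicalSpace X] [ChartedSpace ℂ X] {ν : (x : X) → TangentSpace 𝓘(ℂ) x →L[ℂ] ℂ}
  {γ : ℝ → X}

/-- The quotient `ν / df` on the half `γ (0, ∞)` of the thimble, as a function of the height. -/
def halfAmplitude (f : X → ℂ) (ν : (x : X) → TangentSpace 𝓘(ℂ) x →L[ℂ] ℂ) (a : X) (θ : ℝ)
    (γ : ℝ → X) : ℝ → ℂ :=
  transport (fun s => height f a θ (γ s)) (fun s => formRatio f ν (γ s))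

/-- The function whose Laplace transform is the thimble integral: the difference of the values of
`ν / df` at the two points of the thimble of a given height. -/
def amplitude (f : X → ℂ) (ν : (x : X) → TangentSpace 𝓘(ℂ) x →L[ℂ] ℂ) (a : X) (θ : ℝ)
    (γ : ℝ → X) (t : ℝ) : ℂ :=
  halfAmplitude f ν a θ γ t - halfAmplitude f ν a θ (fun s => γ (-s)) t

namespace IsOrientedThimble

theorem mem_ray (hγ : IsOrientedThimble f a θ γ) (s : ℝ) : f (γ s) ∈ ray (f a) θ :=
  connectedComponentIn_subset (f ⁻¹' ray (f a) θ) a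
    (hγ.range_eq ▸ mem_range_self s : γ s ∈ thimble f a θ)

theorem height_nonneg (hγ : IsOrientedThimble f a θ γ) (s : ℝ) : 0 ≤ height f a θ (γ s) := by
  obtain ⟨t, ht, h⟩ := hγ.mem_ray s
  rwa [height_eq_of_eq h]

theorem apply_eq (hγ : IsOrientedThimble f a θ γ) (s : ℝ) :
    f (γ s) = f a + height f a θ (γ s) * exp (θ * I) := by
  obtain ⟨t, -, h⟩ := hγ.mem_ray s
  rwa [height_eq_of_eq h]

theorem tendsto_height (hγ : IsOrientedThimble f a θ γ) :
    Tendsto (fun s => height f a θ (γ s)) atTop atTop := by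
  refine tendsto_atTop_mono (fun s => ?_)
    (tendsto_atTop_add_const_right _ (-‖f a‖) hγ.tendsto_future)
  have hle := norm_add_le (f a) (height f a θ (γ s) * exp (θ * I))
  rw [← hγ.apply_eq, norm_mul, norm_exp_ofReal_mul_I, mul_one, norm_real,
    Real.norm_of_nonneg (hγ.height_nonneg s)] at hle
  linarith

theorem not_isCriticalPoint (hγ : IsOrientedThimble f a θ γ) {s : ℝ} (hs : s ≠ 0) :
    ¬ IsCriticalPoint f (γ s) := fun hc => hs <| hγ.injective <| by
  rw [hγ.map_zero]
  exact hγ.eq_of_critical _ (hγ.range_eq ▸ mem_range_self s) hc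

theorem reverse (hγ : IsOrientedThimble f a θ γ) :
    IsOrientedThimble f a θ (fun s => γ (-s)) where
  nondegenerate := hγ.nondegenerate
  eq_of_critical := hγ.eq_of_critical
  contMDiff := hγ.contMDiff.comp contDiff_neg.contMDiff
  velocity_ne_zero s := by
    change complexVelocity (fun s => γ (-s)) s ≠ 0
    rw [complexVelocity_comp_neg hγ.contMDiff]
    exact neg_ne_zero.2 (hγ.velocity_ne_zero (-s))
  injective := hγ.injective.comp neg_injective
  map_zero := by rw [neg_zero, hγ.map_zero]
  range_eq := by rw [← hγ.range_eq]; exact neg_surjective.range_comp γ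
  tendsto_future := hγ.tendsto_past.comp tendsto_neg_atTop_atBot
  tendsto_past := hγ.tendsto_future.comp tendsto_neg_atBot_atTop

theorem thimbleIntegrable_mono_re (hγ : IsOrientedThimble f a θ γ) (hf : Continuous f) {z z' : ℂ}
    (hz : ThimbleIntegrable f ν γ z) (hzz' : (z * exp (θ * I)).re ≤ (z' * exp (θ * I)).re) :
    ThimbleIntegrable f ν γ z' := by
  have hcont : Continuous fun s => exp (-((z' - z) * f (γ s))) :=
    continuous_exp.comp (continuous_const.mul (hf.comp hγ.contMDiff.continuous)).neg
  have hbound : ∀ s, ‖exp (-((z' - z) * f (γ s)))‖ ≤ Real.exp (-((z' - z) * f a).re) := fun s => by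
    have hexpand : -((z' - z) * f (γ s)) = -((z' - z) * f a) -
        height f a θ (γ s) * (z' * exp (θ * I) - z * exp (θ * I)) := by
      rw [hγ.apply_eq]
      ring
    rw [norm_exp, hexpand, sub_re, re_ofReal_mul, neg_re, sub_re]
    exact Real.exp_le_exp.2
      (sub_le_self _ (mul_nonneg (hγ.height_nonneg s) (sub_nonneg.2 hzz')))
  refine (Integrable.bdd_mul hz hcont.aestronglyMeasurable (Eventually.of_forall hbound)).congr
    (Eventually.of_forall fun s => ?_)
  simp only [thimbleIntegrand]
  rw [← mul_assoc, ← exp_add]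
  ring_nf

variable [IsManifold 𝓘(ℂ) 1 X]

theorem contDiff_height (hγ : IsOrientedThimble f a θ γ) (hf : MDifferentiable 𝓘(ℂ) 𝓘(ℂ) f) :
    ContDiff ℝ 1 fun s => height f a θ (γ s) :=
  reCLM.contDiff.comp
    (contDiff_const.mul ((contDiff_comp_curve hf hγ.contMDiff).sub contDiff_const))

theorem deriv_comp_curve (hγ : IsOrientedThimble f a θ γ) (hf : MDifferentiable 𝓘(ℂ) 𝓘(ℂ) f)
    (s : ℝ) :
    deriv (f ∘ γ) s = deriv (fun s => height f a θ (γ s)) s * exp (θ * I) := by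
  have hheight := ((hγ.contDiff_height hf).differentiable one_ne_zero s).hasDerivAt
  have heq : f ∘ γ = fun s => f a + height f a θ (γ s) * exp (θ * I) := funext hγ.apply_eq
  rw [heq]
  exact ((hheight.ofReal_comp.mul_const _).const_add _).deriv

theorem isHalfLineChange (hγ : IsOrientedThimble f a θ γ) (hf : MDifferentiable 𝓘(ℂ) 𝓘(ℂ) f) :
    IsHalfLineChange fun s => height f a θ (γ s) where
  contDiff := hγ.contDiff_height hf
  map_zero := by simp [height, hγ.map_zero]
  deriv_ne_zero s hs h0 := by
    have hderiv := (hasDerivAt_comp_curve hf hγ.contMDiff s).deriv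
    rw [hγ.deriv_comp_curve hf, h0, ofReal_zero, zero_mul] at hderiv
    exact differential_apply_ne_zero (hγ.not_isCriticalPoint hs.ne') (hγ.velocity_ne_zero s)
      hderiv.symm
  tendsto_atTop := hγ.tendsto_height

theorem thimbleIntegrand_eqOn (hγ : IsOrientedThimble f a θ γ)
    (hf : MDifferentiable 𝓘(ℂ) 𝓘(ℂ) f) (z : ℂ) :
    EqOn (thimbleIntegrand f ν γ z)
      (fun s => exp (-(f a * z)) * exp (θ * I) *
        (exp (-(z * exp (θ * I) * height f a θ (γ s))) * formRatio f ν (γ s) *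
          deriv (fun s => height f a θ (γ s)) s)) (Ioi 0) := fun s hs => by
  have hexp : exp (-(z * f (γ s))) =
      exp (-(f a * z)) * exp (-(z * exp (θ * I) * height f a θ (γ s))) := by
    rw [← exp_add, hγ.apply_eq]
    ring_nf
  rw [thimbleIntegrand_eq hf hγ.contMDiff (hγ.not_isCriticalPoint (ne_of_gt hs))
    (hγ.velocity_ne_zero s), hγ.deriv_comp_curve hf, hexp]
  ring

theorem laplaceIntegrableAt_halfAmplitude_iff (hγ : IsOrientedThimble f a θ γ)
    (hf : MDifferentiable 𝓘(ℂ) 𝓘(ℂ) f) {z : ℂ} :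
    LaplaceIntegrableAt (halfAmplitude f ν a θ γ) (z * exp (θ * I)) ↔
      IntegrableOn (thimbleIntegrand f ν γ z) (Ioi 0) := by
  rw [halfAmplitude, (hγ.isHalfLineChange hf).laplaceIntegrableAt_transport_iff,
    integrableOn_congr_fun (hγ.thimbleIntegrand_eqOn hf z) measurableSet_Ioi, IntegrableOn,
    IntegrableOn,
    integrable_const_mul_iff (mul_ne_zero (exp_ne_zero _) (exp_ne_zero _)).isUnit]

theorem setIntegral_thimbleIntegrand (hγ : IsOrientedThimble f a θ γ)
    (hf : MDifferentiable 𝓘(ℂ) 𝓘(ℂ) f) (z : ℂ) :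
    ∫ s in Ioi 0, thimbleIntegrand f ν γ z s = exp (-(f a * z)) * exp (θ * I) *
      halfLineLaplace (halfAmplitude f ν a θ γ) (z * exp (θ * I)) := by
  rw [halfAmplitude, (hγ.isHalfLineChange hf).halfLineLaplace_transport,
    setIntegral_congr_fun measurableSet_Ioi (hγ.thimbleIntegrand_eqOn hf z), integral_const_mul]

theorem isRayLaplaceTransform (hγ : IsOrientedThimble f a θ γ)
    (hf : MDifferentiable 𝓘(ℂ) 𝓘(ℂ) f) :
    IsRayLaplaceTransform {z | ThimbleIntegrable f ν γ z} (thimbleIntegral f ν γ) θ (f a)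
      (amplitude f ν a θ γ) := by
  have hhalf : ∀ {γ : ℝ → X}, IsOrientedThimble f a θ γ → ∀ {z}, ThimbleIntegrable f ν γ z →
      LaplaceIntegrableAt (halfAmplitude f ν a θ γ) (z * exp (θ * I)) := fun hγ z hz =>
    (hγ.laplaceIntegrableAt_halfAmplitude_iff hf).2 (Integrable.integrableOn hz)
  have hreverse : ∀ {z}, ThimbleIntegrable f ν γ z →
      ThimbleIntegrable f ν (fun s => γ (-s)) z := fun {z} hz => by
    rw [ThimbleIntegrable, funext (thimbleIntegrand_comp_neg hγ.contMDiff z)]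
    exact (Integrable.comp_neg hz).neg
  refine ⟨fun z hz z' => hγ.thimbleIntegrable_mono_re hf.continuous hz,
    fun z hz => (hhalf hγ hz).sub (hhalf hγ.reverse (hreverse hz)), fun z hz => ?_⟩
  calc thimbleIntegral f ν γ z
      = (∫ s in Ioi (0 : ℝ), thimbleIntegrand f ν γ z (-s)) +
          ∫ s in Ioi (0 : ℝ), thimbleIntegrand f ν γ z s := by
        rw [integral_comp_neg_Ioi, neg_zero, intervalIntegral.integral_Iic_add_Ioi
          (Integrable.integrableOn hz) (Integrable.integrableOn hz), thimbleIntegral]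
    _ = (∫ s in Ioi (0 : ℝ), thimbleIntegrand f ν γ z s) -
          ∫ s in Ioi (0 : ℝ), thimbleIntegrand f ν (fun s => γ (-s)) z s := by
        simp only [thimbleIntegrand_comp_neg hγ.contMDiff, integral_neg]
        ring
    _ = exp (-(f a * z)) * exp (θ * I) *
          halfLineLaplace (amplitude f ν a θ γ) (z * exp (θ * I)) := by
        rw [hγ.setIntegral_thimbleIntegrand hf, hγ.reverse.setIntegral_thimbleIntegrand hf,
          ← mul_sub, ← halfLineLaplace_sub (hhalf hγ hz) (hhalf hγ.reverse (hreverse hz))]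
        rfl

theorem analyticOnNhd_halfAmplitude (hγ : IsOrientedThimble f a θ γ)
    (hf : MDifferentiable 𝓘(ℂ) 𝓘(ℂ) f) (hν : IsHolomorphicOneForm ν) :
    AnalyticOnNhd ℝ (halfAmplitude f ν a θ γ) (Ioi 0) := fun t ht => by
  obtain ⟨s, hs, rfl⟩ := (hγ.isHalfLineChange hf).exists_eq ht
  obtain ⟨ψ, hψ, hψf⟩ := exists_formRatio_eq_comp hf hν (hγ.not_isCriticalPoint hs.ne')
  rw [hγ.apply_eq] at hψ
  have hline : AnalyticAt ℝ (fun t : ℝ => f a + t * exp (θ * I)) (height f a θ (γ s)) :=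
    analyticAt_const.add ((ofRealCLM.analyticAt _).mul analyticAt_const)
  have hψline : AnalyticAt ℝ (fun t : ℝ => ψ (f a + t * exp (θ * I))) (height f a θ (γ s)) :=
    hψ.restrictScalars.fun_comp_of_eq hline rfl
  refine (hγ.isHalfLineChange hf).analyticAt_transport hs hψline ?_
  filter_upwards [hγ.contMDiff.continuous.continuousAt.eventually hψf] with s' hs'
  rw [hs', hγ.apply_eq]

theorem exists_formRatio_eq_sqrt_height (hγ : IsOrientedThimble f a θ γ)
    (hf : MDifferentiable 𝓘(ℂ) 𝓘(ℂ) f) (hν : IsHolomorphicOneForm ν) :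
    ∃ κ : ℂ → ℂ, AnalyticAt ℂ κ 0 ∧ ∀ᶠ s in 𝓝 (0 : ℝ),
      formRatio f ν (γ s) = κ (SignType.sign s * √(height f a θ (γ s)) : ℝ) /
        (SignType.sign s * √(height f a θ (γ s)) : ℝ) := by
  obtain ⟨y, c, k, hy, hc, hy0, hk, hyk⟩ := exists_morse_coordinate_along_curve hf hν
    hγ.contMDiff (hγ.velocity_ne_zero 0) (hγ.map_zero ▸ hγ.nondegenerate)
  set ω : ℂ := exp (θ * I) ^ (1 / 2 : ℂ)
  have hω2 : ω ^ 2 = exp (θ * I) := sq_cpow_half _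
  have hω : ω ≠ 0 := fun h => exp_ne_zero (θ * I) (by rw [← hω2, h, zero_pow two_ne_zero])
  have hsq : ∀ᶠ s in 𝓝 0, (y s / ω) ^ 2 = height f a θ (γ s) := by
    filter_upwards [hyk] with s hs
    rw [div_pow, ← hs.1, hω2, hγ.map_zero, hγ.apply_eq, add_sub_cancel_left,
      mul_div_cancel_right₀ _ (exp_ne_zero _)]
  obtain ⟨σ, hσ, hyσ⟩ := exists_eventually_eq_mul_sign_mul_sqrt (hy.div_const ω)
    (div_ne_zero hc hω) (by rw [hy0, zero_div]) hγ.height_nonneg hsq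
  refine ⟨fun v => k (ω * σ * v) / (ω * σ), ?_, ?_⟩
  · have hscale : AnalyticAt ℂ (fun v => ω * σ * v) 0 := analyticAt_const.fun_mul analyticAt_id
    exact (hk.fun_comp_of_eq hscale (mul_zero _)).fun_div analyticAt_const (mul_ne_zero hω hσ)
  · filter_upwards [hyk, hyσ] with s hs hsσ
    rw [div_eq_iff hω] at hsσ
    rw [hs.2, hsσ, div_div]
    ring_nf

theorem exists_amplitude_eq (hγ : IsOrientedThimble f a θ γ)
    (hf : MDifferentiable 𝓘(ℂ) 𝓘(ℂ) f) (hν : IsHolomorphicOneForm ν) :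
    ∃ G : ℂ → ℂ, AnalyticAt ℂ G 0 ∧
      ∀ᶠ t : ℝ in 𝓝[>] 0, amplitude f ν a θ γ t = (t ^ (1 / 2 - 1 : ℝ) : ℝ) * G t := by
  obtain ⟨κ, hκ, hκγ⟩ := hγ.exists_formRatio_eq_sqrt_height hf hν
  have hfuture : ∀ᶠ t : ℝ in 𝓝[>] 0, halfAmplitude f ν a θ γ t = κ √t / √t := by
    refine (hγ.isHalfLineChange hf).eventually_nhdsGT ?_
    filter_upwards [nhdsWithin_le_nhds hκγ, self_mem_nhdsWithin] with s hs (hpos : 0 < s)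
    rw [halfAmplitude, (hγ.isHalfLineChange hf).transport_apply hpos]
    simpa [sign_pos hpos] using hs
  have hpast : ∀ᶠ t : ℝ in 𝓝[>] 0,
      halfAmplitude f ν a θ (fun s => γ (-s)) t = κ (-√t) / -√t := by
    refine (hγ.reverse.isHalfLineChange hf).eventually_nhdsGT ?_
    have hneg := (continuous_neg.tendsto' (0 : ℝ) 0 neg_zero).eventually hκγ
    filter_upwards [nhdsWithin_le_nhds hneg, self_mem_nhdsWithin] with s hs (hpos : 0 < s)
    rw [halfAmplitude, (hγ.reverse.isHalfLineChange hf).transport_apply hpos]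
    simpa [sign_neg (neg_lt_zero.2 hpos)] using hs
  obtain ⟨G, hG, hGκ⟩ := exists_comp_sq_eventuallyEq_of_even
    (E := fun v => κ v + κ (-v)) (hκ.fun_add (AnalyticAt.comp (by rwa [neg_zero])
      analyticAt_id.neg)) (Eventually.of_forall fun v => by rw [neg_neg, add_comm])
  have hsqrt : Tendsto (fun t : ℝ => (√t : ℂ)) (𝓝[>] 0) (𝓝 0) :=
    ((continuous_ofReal.comp Real.continuous_sqrt).tendsto' 0 0 (by simp)).mono_left
      nhdsWithin_le_nhds
  refine ⟨G, hG, ?_⟩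
  filter_upwards [hfuture, hpast, hsqrt.eventually hGκ, self_mem_nhdsWithin]
    with t h₁ h₂ hG (ht : 0 < t)
  rw [← ofReal_pow, Real.sq_sqrt ht.le] at hG
  rw [amplitude, h₁, h₂, ← hG, show (1 / 2 - 1 : ℝ) = -(1 / 2) by norm_num,
    Real.rpow_neg ht.le, ← Real.sqrt_eq_rpow, ofReal_inv]
  ring

end IsOrientedThimble

end OrientedThimble

end Thimble

end

theorem theorem1p9_general {X : Type*} [TopologicalSpace X] [ChartedSpace ℂ X]
    [IsManifold 𝓘(ℂ) 1 X]
    (f : X → ℂ) (hf : MDifferentiable 𝓘(ℂ) 𝓘(ℂ) f)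
    (ν : (x : X) → TangentSpace 𝓘(ℂ) x →L[ℂ] ℂ) (hν : Thimble.IsHolomorphicOneForm ν)
    (a : X) (θ : ℝ) (γ : ℝ → X) (hγ : Thimble.IsOrientedThimble f a θ γ)
    (hconv : ∃ z₀ : ℂ, Thimble.ThimbleIntegrable f ν γ z₀) :
    Thimble.IsBorelRegular {z : ℂ | Thimble.ThimbleIntegrable f ν γ z}
      (Thimble.thimbleIntegral f ν γ) θ (f a) (1 / 2) := by
  have hLaplace := hγ.isRayLaplaceTransform (ν := ν) hf
  obtain ⟨G, hG, hJG⟩ := hγ.exists_amplitude_eq hf hν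
  exact hLaplace.isBorelRegular hconv one_half_pos
    ((hγ.analyticOnNhd_halfAmplitude hf hν).sub (hγ.reverse.analyticOnNhd_halfAmplitude hf hν))
    hG hJG

theorem theorem1p9 {X : Type*} [TopologicalSpace X] [T2Space X] [ChartedSpace ℂ X]
    [IsManifold 𝓘(ℂ) 1 X]
    (f : X → ℂ) (hf : MDifferentiable 𝓘(ℂ) 𝓘(ℂ) f)
    (hcrit : ∀ x, Thimble.IsCriticalPoint f x → Thimble.IsNondegenerateCriticalPoint f x)
    (ν : (x : X) → TangentSpace 𝓘(ℂ) x →L[ℂ] ℂ) (hν : Thimble.IsHolomorphicOneForm ν)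
    (a : X) (θ : ℝ) (γ : ℝ → X) (hγ : Thimble.IsOrientedThimble f a θ γ)
    (hconv : ∃ z₀ : ℂ, Thimble.ThimbleIntegrable f ν γ z₀) :
    Thimble.IsBorelRegular {z : ℂ | Thimble.ThimbleIntegrable f ν γ z}
      (Thimble.thimbleIntegral f ν γ) θ (f a) (1 / 2) :=
  theorem1p9_general f hf ν hν a θ γ hγ hconv
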